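/- Work with trees $S\subseteq 2^{<\omega_1}$ closed under restriction, ordered by extension $\le_S$; for a node $t$ let $ht(t)=\mathrm{dom}(t)$, and let $D_{s,t}=\{\xi<\min(ht(s),ht(t)): s(\xi)\ne t(\xi)\}$. Such an $S$ is a Suslin tree if it is uncountable and has no uncountable chain and no uncountable antichain; it is coherent if $D_{s,t}$ is finite for all $s,t\in S$; a coherent $S$ is complete if $t\in S$ whenever $s\in S$, $t\in 2^{ht(s)}$ and $D_{s,t}$ is finite. For a Suslin tree $S$, $\mathrm{PFA}(S)$ is the assertion that for every proper poset $\mathcal P$ such that $\Vdash_{\mathcal P}$ "$S$ is Suslin", and for every collection $\{D_\alpha:\alpha<\omega_1\}$ of dense subsets of $\mathcal P$, there is a filter $G\subseteq\mathcal P$ meeting every $D_\alpha$. For finite $a\subseteq S$, let $a(0),a(1),\dots$ be the enumeration of $a$ that is increasing in height (nodes of the same height being ordered lexicographically). For $0<n<\omega$, let $\mathcal C^0_n$ be the collection of all uncountable $A\subseteq[S]^{2n}$ such that for some $s\in S$: (1) for all $a\in A$, $s^\smallfrown 0<_S a(0)<_S\dots<_S a(n-1)$ and $s^\smallfrown 1<_S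 a(n)<_S\dots<_S a(2n-1)$; (2) for all $a\in A$, $ht(a(n-1))<ht(a(n))$; (3) for all $a\in A$, $D_{a(n-1),a(n)}=\{ht(s)\}$; (4) for all $a\neq b$ in $A$, either $ht(a(2n-1))<ht(b(0))$ or $ht(b(2n-1))<ht(a(0))$. Let $\mathcal C^0=\bigcup_{0<n<\omega}\mathcal C^0_n$, and for $A\in\mathcal C^0$ let $N_A$ be the $n$ with $A\in\mathcal C^0_n$. For $c:[S]^2\to 2$, $\varphi_0(c)$ is the assertion that for all $0<n<\omega$ and all $A_0,\dots,A_{n-1}\in\mathcal C^0$ (repetitions allowed), for every sequence $\langle s_\alpha:\alpha<\omega_1\rangle$ of pairwise distinct elements of $S$ and all $x^i_\alpha\in[A_i]^{<\omega}$ ($i<n$, $\alpha<\omega_1$) such that for each $i<n$ the sets $x^i_\alpha$ ($\alpha<\omega_1$) are pairwise disjoint, there are $\alpha<\beta<\omega_1$ such that $s_\alpha<_S s_\beta$ and, for all $i<n$, $a\in x^i_\alpha$, $b\in x^i_\beta$, there is $j<2$ with $$c(a(k),b(k'))=j\quad\text{and}\quad c(a(N_{A_i}+k),b(N_{A_i}+k'))=1-j\qquad\text{for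 all }k,k'<N_{A_i}.$$ **Theorem.** Let $S$ be a complete coherent Suslin tree and let $c:[S]^2\to 2$ be any coloring. If $\mathrm{PFA}(S)$ holds, then $\varphi_0(c)$ fails. -/

import Mathlib

noncomputable section

namespace SuslinPFA

/-! ### Nodes of the binary tree of countable height -/

/-- The first uncountable ordinal, as a well-ordered type. -/
abbrev Omega1 : Type := (Ordinal.omega.{0} 1).ToType

/-- An element of `2^{<ω₁}`: a function from a countable ordinal `ht` to `2 = {0, 1}`. -/
@[ext]
structure Node : Type where
  ht : Omega1
  val : Set.Iio ht → Fin 2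

namespace Node

/-- `s ≤ t` means that the function `t` extends the function `s`. -/
instance : PartialOrder Node where
  le s t := ∃ h : s.ht ≤ t.ht, ∀ ξ (hξ : ξ < s.ht), s.val ⟨ξ, hξ⟩ = t.val ⟨ξ, hξ.trans_le h⟩
  le_refl s := ⟨le_rfl, fun _ _ => rfl⟩
  le_trans s t u := by
    rintro ⟨h₁, e₁⟩ ⟨h₂, e₂⟩
    exact ⟨h₁.trans h₂, fun ξ hξ => (e₁ ξ hξ).trans (e₂ ξ (hξ.trans_le h₁))⟩
  le_antisymm s t := by
    rintro ⟨h₁, e₁⟩ ⟨h₂, -⟩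
    obtain ⟨a, f⟩ := s
    obtain ⟨b, g⟩ := t
    obtain rfl : a = b := le_antisymm h₁ h₂
    congr 1
    funext ξ
    exact e₁ ξ.1 ξ.2

open Classical in
/-- The node `s⌢i` of height `ht s + 1`. -/
def snoc (s : Node) (i : Fin 2) : Node where
  ht := Order.succ s.ht
  val ξ := if h : ξ.1 < s.ht then s.val ⟨ξ.1, h⟩ else i

/-- `D_{s,t}`: the set of `ξ < min (ht s) (ht t)` at which `s` and `t` differ. -/
def diff (s t : Node) : Set Omega1 :=
  {ξ | ∃ (hs : ξ < s.ht) (ht : ξ < t.ht), s.val ⟨ξ, hs⟩ ≠ t.val ⟨ξ, ht⟩}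

end Node

/-! ### Complete coherent Suslin trees -/

/-- `S ⊆ 2^{<ω₁}` (closed under restrictions, so that the height of a node in `S` is its domain)
is a Suslin tree: it is uncountable, and it has no uncountable antichain and no uncountable
chain. -/
structure IsSuslinTree (S : Set Node) : Prop where
  lower : IsLowerSet S
  uncountable : ¬ S.Countable
  antichain : ∀ A ⊆ S, IsAntichain (· ≤ ·) A → A.Countable
  chain : ∀ A ⊆ S, IsChain (· ≤ ·) A → A.Countable

/-- `S` is coherent: any two nodes differ at only finitely many places. -/
def IsCoherent (S : Set Node) : Prop :=
  ∀ s ∈ S, ∀ t ∈ S, (s.diff t).Finite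

/-- `S` is complete: it contains every finite modification of each of its nodes. -/
def IsComplete (S : Set Node) : Prop :=
  ∀ s ∈ S, ∀ t : Node, t.ht = s.ht → (s.diff t).Finite → t ∈ S

/-! ### The partition property -/

/-- The collection `C⁰ₙ` of uncountable families `A ⊆ [S]^{2n}` with a stem `s`.
A set `a ∈ [S]^{2n}` is given by its increasing enumeration `a 0, …, a (2n - 1)` in the height
order; by the first two clauses below the heights are strictly increasing along this enumeration.
`Fin.castAdd n k` is the index `k`, and `Fin.natAdd n k` is the index `n + k`, for `k < n`.
As heights increase, comparisons with `a (n - 1)`, `a n`, `a 0`, `a (2n - 1)` are written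
with all the indices concerned. -/
def IsC0 (S : Set Node) (n : ℕ) (A : Set (Fin (n + n) → S)) : Prop :=
  0 < n ∧ ¬ A.Countable ∧ ∃ s ∈ S,
    (∀ a ∈ A,
      ((∀ k : Fin n, s.snoc 0 < a (Fin.castAdd n k)) ∧
        ∀ k k' : Fin n, k < k' → a (Fin.castAdd n k) < a (Fin.castAdd n k')) ∧
      ((∀ k : Fin n, s.snoc 1 < a (Fin.natAdd n k)) ∧
        ∀ k k' : Fin n, k < k' → a (Fin.natAdd n k) < a (Fin.natAdd n k')) ∧
      (∀ k k' : Fin n, (a (Fin.castAdd n k)).1.ht < (a (Fin.natAdd n k')).1.ht) ∧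
      (∀ k k' : Fin n, (a (Fin.castAdd n k)).1.diff (a (Fin.natAdd n k')) = {s.ht})) ∧
    ∀ a ∈ A, ∀ b ∈ A, a ≠ b →
      (∀ i j, (a i).1.ht < (b j).1.ht) ∨ (∀ i j, (b j).1.ht < (a i).1.ht)

/-- `φ₀(c, A₀, …, A_{n-1})`, where `A i` is a family of sets of size `2 * N i`. The colour `1 - j`
is the one other than `j`. The arguments of `c` are always distinct nodes here. -/
def Phi0For {S : Set Node} (c : Sym2 S → Fin 2) {n : ℕ} (N : Fin n → ℕ)
    (A : (i : Fin n) → Set (Fin (N i + N i) → S)) : Prop :=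
  ∀ (s : Omega1 → S) (x : (i : Fin n) → Omega1 → Finset (Fin (N i + N i) → S)),
    Function.Injective s →
    (∀ i α, (x i α : Set (Fin (N i + N i) → S)) ⊆ A i) →
    (∀ i α β, α ≠ β → Disjoint (x i α) (x i β)) →
    ∃ α β, α < β ∧ s α < s β ∧
      ∀ i, ∀ a ∈ x i α, ∀ b ∈ x i β, ∃ j : Fin 2, ∀ k k' : Fin (N i),
        c s(a (Fin.castAdd (N i) k), b (Fin.castAdd (N i) k')) = j ∧
        c s(a (Fin.natAdd (N i) k), b (Fin.natAdd (N i) k')) = 1 - j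

/-- `φ₀(c)`, for a colouring `c : [S]² → 2`. (The values of `c` at the diagonal are irrelevant:
distinct members of a family in `C⁰` have no node in common.) -/
def Phi0 {S : Set Node} (c : Sym2 S → Fin 2) : Prop :=
  ∀ (n : ℕ) (N : Fin n → ℕ) (A : (i : Fin n) → Set (Fin (N i + N i) → S)),
    0 < n → (∀ i, IsC0 S (N i) (A i)) → Phi0For c N A

/-! ### Proper forcing -/

/-- `D` is dense in the forcing poset `P`. -/
def IsDenseIn {P : Type} [PartialOrder P] (D : Set P) : Prop :=
  ∀ p, ∃ q ≤ p, q ∈ D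

/-- `C` is a closed unbounded set of countable subsets of `X`. -/
structure IsClub {X : Type} (C : Set (Set X)) : Prop where
  countable : ∀ M ∈ C, M.Countable
  unbounded : ∀ M : Set X, M.Countable → ∃ N ∈ C, M ⊆ N
  closed : ∀ M : ℕ → Set X, Monotone M → (∀ k, M k ∈ C) → (⋃ k, M k) ∈ C

/-- `q` is an `(M, P)`-generic condition, where `M` is a set of conditions and of sets of
conditions: for every dense set `D ∈ M`, the set `D ∩ M` is predense below `q`. -/
def IsGenericCondition {P : Type} [PartialOrder P] (M : Set (P ⊕ Set P)) (q : P) : Prop :=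
  ∀ D : Set P, Sum.inr D ∈ M → IsDenseIn D →
    ∀ r ≤ q, ∃ d ∈ D, Sum.inl d ∈ M ∧ ∃ e, e ≤ d ∧ e ≤ r

/-- `P` is proper: for a club of countable `M ⊆ P ∪ 𝒫(P)`, each condition in `M` has an
`(M, P)`-generic extension. -/
def IsProper (P : Type) [PartialOrder P] : Prop :=
  ∃ C : Set (Set (P ⊕ Set P)), IsClub C ∧
    ∀ M ∈ C, ∀ p : P, Sum.inl p ∈ M → ∃ q ≤ p, IsGenericCondition M q

/-! ### Forcing that a tree is Suslin -/

/-- A `P`-name for a subset of the ground model set `X`: a set of pairs `(x̌, p)`. -/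
abbrev Name (P X : Type) : Type := Set (X × P)

section Forcing

variable {P X : Type} [PartialOrder P]

/-- `p ⊩ x̌ ∈ A`. -/
def ForcesMem (p : P) (x : X) (A : Name P X) : Prop :=
  ∀ q ≤ p, ∃ r ≤ q, ∃ a, (x, a) ∈ A ∧ r ≤ a

/-- `p ⊩ A is countable`: there is a name `f` such that `p` forces that `f` is a partial function
on `ω` whose range includes `A`. -/
def ForcesCountable (p : P) (A : Name P X) : Prop :=
  ∃ f : Name P (ℕ × X),
    (∀ q ≤ p, ∀ (k : ℕ) (x y : X), ForcesMem q (k, x) f → ForcesMem q (k, y) f → x = y) ∧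
    ∀ q ≤ p, ∀ x : X, ForcesMem q x A → ∃ r ≤ q, ∃ k : ℕ, ForcesMem r (k, x) f

/-- `p ⊩ A is uncountable`. -/
def ForcesUncountable (p : P) (A : Name P X) : Prop :=
  ∀ q ≤ p, ¬ ForcesCountable q A

/-- `p ⊩ A is an antichain`. -/
def ForcesAntichain [PartialOrder X] (p : P) (A : Name P X) : Prop :=
  ∀ q ≤ p, ∀ s t : X, ForcesMem q s A → ForcesMem q t A → s ≠ t → ¬ s ≤ t

/-- `p ⊩ A is a chain`. -/
def ForcesChain [PartialOrder X] (p : P) (A : Name P X) : Prop :=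
  ∀ q ≤ p, ∀ s t : X, ForcesMem q s A → ForcesMem q t A → s ≤ t ∨ t ≤ s

end Forcing

/-- `⊩_P S is Suslin`: every condition forces that `Š` is uncountable and that no uncountable
subset of `Š` is an antichain or a chain. -/
def ForcesSuslin (P : Type) [PartialOrder P] (S : Set Node) : Prop :=
  (∀ p : P, ForcesUncountable p (Set.univ : Name P S)) ∧
    ∀ (p : P) (A : Name P S), ForcesUncountable p A →
      ¬ ForcesAntichain p A ∧ ¬ ForcesChain p A

/-- `PFA(S)`: for every proper poset `P` that forces `S` to be Suslin, and every family of `ω₁`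
dense subsets of `P`, there is a filter meeting them all. -/
def PFA (S : Set Node) : Prop :=
  ∀ (P : Type) [PartialOrder P] [Nonempty P], IsProper P → ForcesSuslin P S →
    ∀ D : Omega1 → Set P, (∀ α, IsDenseIn (D α)) →
      ∃ G : Order.PFilter P, ∀ α, ∃ p ∈ G, p ∈ D α

end SuslinPFA

end

noncomputable section

namespace SuslinPFA

/-! ### The first uncountable ordinal -/

namespace Omega1

/-! Assume `Phi0 c`. The proof works with sequences of pairs of nodes `b α ≤ s α` of increasing
heights and shows that such a sequence can be thinned out, its `s α` being extended, until it is
`Blocked` for both colours; this contradicts `Phi0 c`.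

The forcing part is a dichotomy for a relation `E` on `ω₁` (`exists_homogeneous`): under `PFA(S)`
there is an uncountable `E`-homogeneous set, unless `HasSmallName S E`. The poset consists of finite
homogeneous sets with finite `∈`-chains of countable models as side conditions, and the points above
a model are generic over it in the sense of iterated largeness (`LargeN`). Everything needed about
the poset comes from one reflection lemma, `Obj.reflect`: if a condition containing a model and a
node above the model's height stand in a relation from the model, then so do a compatible condition
from the model and a smaller node. This gives properness, preservation of `S`
(`Reflecting.forcesSuslin`) and an unbounded generic set.

Let `E α β` say that `s α < s β` implies that `b α`, `b β` get colour `j`. A homogeneous set yields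
blocks of length one whose two halves both take colour `j`, against `Phi0 c`
(`not_phi0_of_homogeneous`). So there is a small name, and by coherence its nodes can be aligned
with the `s α` by one fixed finite modification; the result is blocked for `j`
(`PairSeq.exists_blocked`). This is done for `j = 0`, then for `j = 1`.

For a sequence blocked for both colours (`not_phi0_of_blocked`), pressing down makes the blocking
nodes uniform. Blocks of length two, formed by a node below `t` and a blocking node above `t`, must
show one colour to an earlier `b ξ` by `Phi0 c`; blocking for that colour forbids this. -/

theorem countable_Iio (a : Omega1) : (Set.Iio a).Countable := by
  have h : Cardinal.mk (Set.Iio a) < Cardinal.aleph 1 := by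
    have h1 : _ < Ordinal.omega 1 := Ordinal.typein_lt_self a
    have h2 := Cardinal.lt_ord.1 (h1.trans_eq (Cardinal.ord_aleph 1).symm)
    rwa [Ordinal.card_typein] at h2
  rw [← Set.countable_coe_iff, ← Cardinal.mk_le_aleph0_iff]
  rw [← Order.lt_succ_iff, Cardinal.succ_aleph0]
  exact h

theorem not_countable_univ : ¬ (Set.univ : Set Omega1).Countable := by
  rw [Set.countable_univ_iff, ← Cardinal.mk_le_aleph0_iff, Cardinal.mk_toType, not_le,
    Ordinal.card_omega]
  exact Cardinal.aleph0_lt_aleph_one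

instance : Nonempty Omega1 := by
  by_contra h
  rw [not_nonempty_iff] at h
  exact not_countable_univ (Set.countable_univ_iff.2 inferInstance)

theorem countable_Iic (a : Omega1) : (Set.Iic a).Countable := by
  rw [← Set.Iio_insert]
  exact (countable_Iio a).insert a

theorem exists_gt_of_countable {s : Set Omega1} (hs : s.Countable) : ∃ a, ∀ x ∈ s, x < a := by
  by_contra! h
  refine not_countable_univ ((hs.biUnion fun x _ => countable_Iic x).mono fun a _ => ?_)
  obtain ⟨x, hx, hax⟩ := h a
  exact Set.mem_biUnion hx hax

instance : NoMaxOrder Omega1 where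
  exists_gt a := by
    obtain ⟨b, hb⟩ := exists_gt_of_countable (Set.countable_singleton a)
    exact ⟨b, hb a rfl⟩

theorem countable_of_lt {s : Set Omega1} {a : Omega1} (h : ∀ x ∈ s, x < a) : s.Countable :=
  (countable_Iio a).mono h

theorem exists_ge_of_not_countable {s : Set Omega1} (hs : ¬ s.Countable) (a : Omega1) :
    ∃ x ∈ s, a ≤ x := by
  by_contra! h
  exact hs (countable_of_lt h)

theorem not_countable_of_unbounded {s : Set Omega1} (h : ∀ a, ∃ x ∈ s, a ≤ x) :
    ¬ s.Countable := fun hs => by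
  obtain ⟨a, ha⟩ := exists_gt_of_countable hs
  obtain ⟨x, hx, hax⟩ := h a
  exact (ha x hx).not_ge hax

/-- The least strict upper bound of a sequence. -/
theorem exists_lub (a : ℕ → Omega1) : ∃ δ, (∀ n, a n < δ) ∧ ∀ x < δ, ∃ n, x ≤ a n := by
  obtain ⟨b, hb⟩ := exists_gt_of_countable (Set.countable_range a)
  have hne : {d | ∀ n, a n < d}.Nonempty := ⟨b, fun n => hb _ ⟨n, rfl⟩⟩
  refine ⟨wellFounded_lt.min _ hne, wellFounded_lt.min_mem _ hne, fun x hx => ?_⟩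
  by_contra! h
  exact wellFounded_lt.not_lt_min (s := {d | ∀ n, a n < d}) h hx

/-- Limit ordinals, in the form in which they are used here. -/
def IsLim (l : Omega1) : Prop := (∃ a, a < l) ∧ ∀ a < l, ∃ b < l, a < b

/-- A regressive function on the limit ordinals is bounded on an uncountable set. -/
theorem pressing_down (f : Omega1 → Omega1) (hf : ∀ l, IsLim l → f l < l) :
    ∃ θ, ¬ {l | IsLim l ∧ f l ≤ θ}.Countable := by
  by_contra! h
  choose g hg using fun θ => exists_gt_of_countable (h θ)
  choose u hu using fun a : Omega1 => exists_gt a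
  -- If every `{l | f l ≤ θ}` were bounded by `g θ`, the supremum `δ` of this sequence would be a
  -- limit closed under `g`, and `f δ ≤ a n` would put `δ` below `a (n + 1)`.
  let a : ℕ → Omega1 := fun n => Nat.rec (Classical.arbitrary _) (fun _ x => max (g x) (u x)) n
  obtain ⟨δ, h1, h2⟩ := exists_lub a
  have hs : ∀ n, a (n + 1) = max (g (a n)) (u (a n)) := fun n => rfl
  have hl : IsLim δ := by
    refine ⟨⟨_, h1 0⟩, fun x hx => ?_⟩
    obtain ⟨n, hn⟩ := h2 x hx
    refine ⟨a (n + 1), h1 (n + 1), hn.trans_lt ((hu _).trans_le ?_)⟩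
    rw [hs]
    exact le_max_right _ _
  obtain ⟨n, hn⟩ := h2 _ (hf δ hl)
  have h3 := hg (a n) δ ⟨hl, hn⟩
  have h4 := h1 (n + 1)
  rw [hs] at h4
  exact absurd ((h3.trans_le (le_max_left _ _)).trans h4) (lt_irrefl _)

/-- Transfinite choice of a sequence, each term being chosen far beyond the earlier ones. -/
theorem exists_seq {X : Type*} (Q : Omega1 → X → Prop) (hQ : ∀ γ, ∃ x, Q γ x)
    (bd : X → Omega1) :
    ∃ f : Omega1 → X, ∀ ξ, ∃ γ, Q γ (f ξ) ∧ ξ < γ ∧ ∀ η < ξ, bd (f η) < γ := by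
  choose G hG using hQ
  have hb : ∀ (ξ : Omega1) (p : ∀ η, η < ξ → X), ∃ γ, ξ < γ ∧ ∀ η (h : η < ξ), bd (p η h) < γ := by
    intro ξ p
    have hc : (insert ξ (Set.range fun η : Set.Iio ξ => bd (p η.1 η.2))).Countable := by
      have := (countable_Iio ξ).to_subtype
      exact (Set.countable_range _).insert _
    obtain ⟨γ, hγ⟩ := exists_gt_of_countable hc
    exact ⟨γ, hγ _ (Set.mem_insert _ _), fun η h =>
      hγ _ (Set.mem_insert_of_mem _ ⟨⟨η, h⟩, rfl⟩)⟩
  choose g hg1 hg2 using hb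
  let f : Omega1 → X := wellFounded_lt.fix fun ξ p => G (g ξ p)
  refine ⟨f, fun ξ => ⟨g ξ fun η _ => f η, ?_, hg1 _ _, fun η h => hg2 ξ (fun η _ => f η) η h⟩⟩
  have : f ξ = G (g ξ fun η _ => f η) := wellFounded_lt.fix_eq _ _
  rw [this]
  exact hG _

theorem le_of_strictMono {f : Omega1 → Omega1} (hf : StrictMono f) (a : Omega1) : a ≤ f a :=
  hf.le_apply

end Omega1

/-! ### Nodes -/

namespace Node

/-- The value of a node at `ξ`, which is `0` beyond its height. -/
def app (t : Node) (ξ : Omega1) : Fin 2 :=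
  open Classical in if h : ξ < t.ht then t.val ⟨ξ, h⟩ else 0

/-- The node of height `a` given by `f`. -/
def ofFun (a : Omega1) (f : Omega1 → Fin 2) : Node := ⟨a, fun ξ => f ξ.1⟩

theorem app_of_lt {t : Node} {ξ : Omega1} (h : ξ < t.ht) : t.app ξ = t.val ⟨ξ, h⟩ := dif_pos h

theorem app_ofFun {a : Omega1} {f : Omega1 → Fin 2} {ξ : Omega1} (h : ξ < a) :
    (ofFun a f).app ξ = f ξ := app_of_lt (t := ofFun a f) h

theorem le_iff {s t : Node} : s ≤ t ↔ s.ht ≤ t.ht ∧ ∀ ξ < s.ht, s.app ξ = t.app ξ := by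
  constructor
  · rintro ⟨h, e⟩
    refine ⟨h, fun ξ hξ => ?_⟩
    rw [app_of_lt hξ, app_of_lt (hξ.trans_le h), e]
  · rintro ⟨h, e⟩
    refine ⟨h, fun ξ hξ => ?_⟩
    rw [← app_of_lt hξ, ← app_of_lt (hξ.trans_le h), e ξ hξ]

theorem ht_mono {s t : Node} (h : s ≤ t) : s.ht ≤ t.ht := (le_iff.1 h).1

theorem eq_of_le {s t : Node} (h : s ≤ t) (h' : t.ht ≤ s.ht) : s = t :=
  le_antisymm h (le_iff.2 ⟨h', fun ξ hξ => ((le_iff.1 h).2 ξ (hξ.trans_le h')).symm⟩)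

theorem ht_strictMono {s t : Node} (h : s < t) : s.ht < t.ht :=
  lt_of_not_ge fun h' => h.ne (eq_of_le h.le h')

theorem lt_of_le {s t : Node} (h : s ≤ t) (h' : s.ht < t.ht) : s < t :=
  lt_of_le_of_ne h fun e => by rw [e] at h'; exact lt_irrefl _ h'

theorem le_of_le {s t u : Node} (hs : s ≤ u) (ht : t ≤ u) (h : s.ht ≤ t.ht) : s ≤ t :=
  le_iff.2 ⟨h, fun ξ hξ => ((le_iff.1 hs).2 ξ hξ).trans
    ((le_iff.1 ht).2 ξ (hξ.trans_le h)).symm⟩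

theorem mem_diff {s t : Node} {ξ : Omega1} :
    ξ ∈ s.diff t ↔ ξ < s.ht ∧ ξ < t.ht ∧ s.app ξ ≠ t.app ξ := by
  constructor
  · rintro ⟨h, h', e⟩
    exact ⟨h, h', by rwa [app_of_lt h, app_of_lt h']⟩
  · rintro ⟨h, h', e⟩
    exact ⟨h, h', by rwa [app_of_lt h, app_of_lt h'] at e⟩

/-- The restriction of a node. -/
def restr (t : Node) (a : Omega1) : Node := ofFun (min a t.ht) t.app

theorem restr_le (t : Node) (a : Omega1) : t.restr a ≤ t :=
  le_iff.2 ⟨min_le_right _ _, fun _ hξ => app_ofFun hξ⟩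

theorem ht_restr {t : Node} {a : Omega1} (h : a ≤ t.ht) : (t.restr a).ht = a := min_eq_left h

/-- The node that differs from `t` at the members of `F`. -/
def flip (t : Node) (F : Set Omega1) : Node :=
  open Classical in ofFun t.ht fun ξ => if ξ ∈ F then 1 - t.app ξ else t.app ξ

@[simp] theorem ht_flip (t : Node) (F : Set Omega1) : (t.flip F).ht = t.ht := rfl

theorem app_flip_of_mem {t : Node} {F : Set Omega1} {ξ : Omega1} (h : ξ < t.ht) (hF : ξ ∈ F) :
    (t.flip F).app ξ = 1 - t.app ξ := by
  rw [flip, app_ofFun h, if_pos hF]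

theorem app_flip_of_notMem {t : Node} {F : Set Omega1} {ξ : Omega1} (h : ξ < t.ht)
    (hF : ξ ∉ F) : (t.flip F).app ξ = t.app ξ := by
  rw [flip, app_ofFun h, if_neg hF]

theorem one_sub_one_sub (i : Fin 2) : 1 - (1 - i) = i := by revert i; decide

theorem one_sub_ne (i : Fin 2) : 1 - i ≠ i := by revert i; decide

theorem eq_one_sub_of_ne {i j : Fin 2} (h : i ≠ j) : i = 1 - j := by revert i j; decide

theorem flip_flip (t : Node) (F : Set Omega1) : (t.flip F).flip F = t := by
  refine eq_of_le (le_iff.2 ⟨le_rfl, fun ξ hξ => ?_⟩) le_rfl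
  have hξ' : ξ < t.ht := hξ
  by_cases h : ξ ∈ F
  · rw [app_flip_of_mem (t := t.flip F) hξ' h, app_flip_of_mem hξ' h, one_sub_one_sub]
  · rw [app_flip_of_notMem (t := t.flip F) hξ' h, app_flip_of_notMem hξ' h]

theorem flip_mono {s t : Node} (h : s ≤ t) (F : Set Omega1) : s.flip F ≤ t.flip F := by
  obtain ⟨h1, h2⟩ := le_iff.1 h
  refine le_iff.2 ⟨h1, fun ξ hξ => ?_⟩
  rw [ht_flip] at hξ
  by_cases hF : ξ ∈ F
  · rw [app_flip_of_mem hξ hF, app_flip_of_mem (hξ.trans_le h1) hF, h2 ξ hξ]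
  · rw [app_flip_of_notMem hξ hF, app_flip_of_notMem (hξ.trans_le h1) hF, h2 ξ hξ]

theorem flip_lt {s t : Node} (h : s < t) (F : Set Omega1) : s.flip F < t.flip F :=
  lt_of_le (flip_mono h.le F) (ht_strictMono (s := s) (t := t) h)

theorem diff_flip_subset (t : Node) (F : Set Omega1) : t.diff (t.flip F) ⊆ F := fun ξ hξ => by
  by_contra h
  obtain ⟨h1, -, h3⟩ := mem_diff.1 hξ
  exact h3 (app_flip_of_notMem h1 h).symm

/-- Changing `t` where it differs from a shorter node `s` gives an extension of `s`. -/
theorem le_flip_diff {s t : Node} (h : s.ht ≤ t.ht) : s ≤ t.flip (t.diff s) := by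
  refine le_iff.2 ⟨h, fun ξ hξ => ?_⟩
  by_cases hF : ξ ∈ t.diff s
  · rw [app_flip_of_mem (hξ.trans_le h) hF]
    exact eq_one_sub_of_ne (mem_diff.1 hF).2.2.symm
  · rw [app_flip_of_notMem (hξ.trans_le h) hF]
    by_contra hne
    exact hF (mem_diff.2 ⟨hξ.trans_le h, hξ, Ne.symm hne⟩)

theorem diff_mono {s s' t t' : Node} (hs : s ≤ s') (ht : t ≤ t') : s.diff t ⊆ s'.diff t' := by
  intro ξ hξ
  obtain ⟨h1, h2, h3⟩ := mem_diff.1 hξ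
  obtain ⟨a1, a2⟩ := le_iff.1 hs
  obtain ⟨b1, b2⟩ := le_iff.1 ht
  exact mem_diff.2 ⟨h1.trans_le a1, h2.trans_le b1, by rwa [← a2 ξ h1, ← b2 ξ h2]⟩

/-- A node is extended by any node, at least as high, from which it does not differ. -/
theorem le_of_diff_empty {s t : Node} (h : s.ht ≤ t.ht) (hd : ∀ ξ < s.ht, ξ ∉ s.diff t) :
    s ≤ t :=
  le_iff.2 ⟨h, fun ξ hξ => by_contra fun hne => hd ξ hξ (mem_diff.2 ⟨hξ, hξ.trans_le h, hne⟩)⟩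

theorem app_snoc_of_lt {s : Node} {i : Fin 2} {ξ : Omega1} (h : ξ < s.ht) :
    (s.snoc i).app ξ = s.app ξ := by
  rw [app_of_lt (t := s.snoc i) (h.trans (Order.lt_succ _)), app_of_lt h]
  exact dif_pos h

theorem app_snoc_ht (s : Node) (i : Fin 2) : (s.snoc i).app s.ht = i := by
  rw [app_of_lt (t := s.snoc i) (Order.lt_succ _)]
  exact dif_neg (lt_irrefl _)

theorem snoc_le_iff {s t : Node} {i : Fin 2} :
    s.snoc i ≤ t ↔ s ≤ t ∧ s.ht < t.ht ∧ t.app s.ht = i := by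
  constructor
  · intro h
    obtain ⟨h1, h2⟩ := le_iff.1 h
    have h3 : s.ht < t.ht := (Order.lt_succ _).trans_le h1
    refine ⟨le_iff.2 ⟨h3.le, fun ξ hξ => ?_⟩, h3, ?_⟩
    · rw [← h2 ξ (hξ.trans (Order.lt_succ _)), app_snoc_of_lt hξ]
    · rw [← h2 _ (Order.lt_succ _), app_snoc_ht]
  · rintro ⟨h1, h2, h3⟩
    refine le_iff.2 ⟨Order.succ_le_of_lt h2, fun ξ hξ => ?_⟩
    rcases (Order.le_of_lt_succ hξ).lt_or_eq with h | rfl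
    · rw [app_snoc_of_lt h, (le_iff.1 h1).2 ξ h]
    · rw [app_snoc_ht, h3]

end Node

end SuslinPFA
end

noncomputable section

namespace SuslinPFA

/-! ### Complete coherent Suslin trees -/

/-- Complete coherent Suslin trees. -/
structure IsCompleteCoherentSuslin (S : Set Node) : Prop where
  suslin : IsSuslinTree S
  coherent : IsCoherent S
  complete : IsComplete S

namespace IsCompleteCoherentSuslin

variable {S : Set Node}

theorem ht_mono {s t : S} (h : s ≤ t) : s.1.ht ≤ t.1.ht := Node.ht_mono h

theorem ht_strictMono {s t : S} (h : s < t) : s.1.ht < t.1.ht := Node.ht_strictMono h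

theorem lt_of_le {s t : S} (h : s ≤ t) (h' : s.1.ht < t.1.ht) : s < t := Node.lt_of_le h h'

theorem le_of_le {s t u : S} (hs : s ≤ u) (ht : t ≤ u) (h : s.1.ht ≤ t.1.ht) : s ≤ t :=
  Node.le_of_le hs ht h

theorem lt_of_le_of_le {s t u : S} (hs : s ≤ u) (ht : t ≤ u) (h : s.1.ht < t.1.ht) : s < t :=
  lt_of_le (le_of_le hs ht h.le) h

variable (hS : IsCompleteCoherentSuslin S)
include hS

theorem countable_of_antichain {A : Set S} (hA : IsAntichain (· ≤ ·) A) : A.Countable := by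
  have h := hS.suslin.antichain ((↑) '' A) (by rintro _ ⟨s, -, rfl⟩; exact s.2) (by
    rintro _ ⟨s, hs, rfl⟩ _ ⟨t, ht, rfl⟩ hne hle
    exact hA hs ht (fun e => hne (congrArg _ e)) hle)
  exact Set.countable_of_injective_of_countable_image Subtype.val_injective.injOn h

theorem countable_ht_eq (a : Omega1) : {s : S | s.1.ht = a}.Countable :=
  hS.countable_of_antichain fun _ hs _ ht hne hle =>
    hne (Subtype.ext (Node.eq_of_le hle (le_of_eq (Eq.trans ht (Eq.symm hs)))))

theorem countable_ht_lt (a : Omega1) : {s : S | s.1.ht < a}.Countable :=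
  ((Omega1.countable_Iio a).biUnion fun b _ => hS.countable_ht_eq b).mono fun s hs =>
    Set.mem_biUnion (show s.1.ht ∈ Set.Iio a from hs) rfl

theorem exists_ht_ge (a : Omega1) : ∃ s : S, a ≤ s.1.ht := by
  by_contra! h
  refine hS.suslin.uncountable ?_
  rw [← Set.countable_coe_iff, ← Set.countable_univ_iff]
  exact (hS.countable_ht_lt a).mono fun s _ => h s

theorem exists_restr (t : S) {a : Omega1} (h : a ≤ t.1.ht) : ∃ u : S, u ≤ t ∧ u.1.ht = a :=
  ⟨⟨t.1.restr a, hS.suslin.lower (t.1.restr_le a) t.2⟩, t.1.restr_le a, Node.ht_restr h⟩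

theorem flip_mem {t : Node} (ht : t ∈ S) {F : Set Omega1} (hF : F.Finite) : t.flip F ∈ S :=
  hS.complete t ht _ rfl (hF.subset (t.diff_flip_subset F))

theorem exists_ge_ht_ge (t : S) (a : Omega1) : ∃ u : S, t ≤ u ∧ a ≤ u.1.ht := by
  obtain ⟨v, hv⟩ := hS.exists_ht_ge (max a t.1.ht)
  exact ⟨⟨_, hS.flip_mem v.2 (hS.coherent v.1 v.2 t.1 t.2)⟩,
    Node.le_flip_diff ((le_max_right _ _).trans hv), (le_max_left _ _).trans hv⟩

theorem exists_ge_ht_eq (t : S) {a : Omega1} (h : t.1.ht ≤ a) :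
    ∃ u : S, t ≤ u ∧ u.1.ht = a := by
  obtain ⟨v, hv, ha⟩ := hS.exists_ge_ht_ge t a
  obtain ⟨u, hu, e⟩ := hS.exists_restr v ha
  exact ⟨u, le_of_le hv hu (h.trans_eq e.symm), e⟩

theorem exists_gt (t : S) (a : Omega1) : ∃ u : S, t < u ∧ a < u.1.ht := by
  obtain ⟨b, hb⟩ := NoMaxOrder.exists_gt (max a t.1.ht)
  obtain ⟨u, hu, hbu⟩ := hS.exists_ge_ht_ge t b
  exact ⟨u, lt_of_le hu (((le_max_right _ _).trans_lt hb).trans_le hbu),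
    ((le_max_left _ _).trans_lt hb).trans_le hbu⟩

/-- Some proper extension of `s` lies in `S`; either it or its flip at `s.ht` takes the value `i`
there. -/
theorem snoc_mem {s : Node} (hs : s ∈ S) (i : Fin 2) : s.snoc i ∈ S := by
  obtain ⟨u, hu, -⟩ := hS.exists_gt ⟨s, hs⟩ s.ht
  have hlt : s.ht < u.1.ht := ht_strictMono hu
  have hle : s ≤ u.1 := hu.le
  by_cases h : u.1.app s.ht = i
  · exact hS.suslin.lower (Node.snoc_le_iff.2 ⟨hle, hlt, h⟩) u.2
  · refine hS.suslin.lower (Node.snoc_le_iff.2 ⟨?_, ?_, ?_⟩)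
      (hS.flip_mem u.2 (Set.finite_singleton s.ht))
    · refine Node.le_iff.2 ⟨hlt.le, fun ξ hξ => ?_⟩
      rw [Node.app_flip_of_notMem (hξ.trans hlt) (by simpa using hξ.ne)]
      exact (Node.le_iff.1 hle).2 ξ hξ
    · exact hlt
    · rw [Node.app_flip_of_mem hlt (Set.mem_singleton _)]
      exact (Node.eq_one_sub_of_ne (Ne.symm h)).symm

/-- Any set of nodes is decided, below some countable height, by the nodes above that height. -/
theorem exists_level (U : Set S) : ∃ γ : Omega1, ∀ v : S, γ ≤ v.1.ht →
    (∃ u ∈ U, u ≤ v ∧ u.1.ht < γ) ∨ ∀ u ∈ U, ¬ v ≤ u := by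
  -- A maximal antichain of `U` is countable, so a countable `γ` exceeds all its heights; a node
  -- above `γ` that has an extension in `U` must extend a member of it.
  obtain ⟨A, hA⟩ := zorn_subset {A : Set S | A ⊆ U ∧ IsAntichain (· ≤ ·) A} (by
    intro c hc hch
    refine ⟨⋃₀ c, ⟨Set.sUnion_subset fun A hA => (hc hA).1, ?_⟩, fun A hA =>
      Set.subset_sUnion_of_mem hA⟩
    exact (Set.pairwise_sUnion hch.directedOn).2 fun A hA => (hc hA).2)
  have hcount := hS.countable_of_antichain hA.prop.2
  obtain ⟨γ, hγ⟩ := Omega1.exists_gt_of_countable (hcount.image fun u => u.1.ht)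
  refine ⟨γ, fun v hv => or_iff_not_imp_right.2 fun h => ?_⟩
  push Not at h
  obtain ⟨u, hu, hvu⟩ := h
  obtain ⟨a, ha, hau⟩ : ∃ a ∈ A, a ≤ u ∨ u ≤ a := by
    by_contra! hno
    have hins : insert u A ⊆ A := hA.le_of_ge ⟨Set.insert_subset hu hA.prop.1,
      hA.prop.2.insert (fun a ha _ => (hno a ha).1) (fun a ha _ => (hno a ha).2)⟩
      (Set.subset_insert _ _)
    exact (hno u (hins (Set.mem_insert _ _))).1 le_rfl
  have haγ : a.1.ht < γ := hγ _ ⟨a, ha, rfl⟩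
  have hlt : a.1.ht < v.1.ht := haγ.trans_le hv
  have hau' : a ≤ u := hau.elim id fun h' =>
    absurd (ht_mono h') (hlt.trans_le (ht_mono hvu)).not_ge
  exact ⟨a, hA.prop.1 ha, le_of_le hau' hvu hlt.le, haγ⟩

/-- An uncountable family of nodes is dense, and even uncountable in each cone, above some
node. -/
theorem exists_dense {w : Omega1 → S} (hw : Function.Injective w) {K : Set Omega1}
    (hK : ¬ K.Countable) : ∃ s : S, ∀ t, s ≤ t → ¬ {α ∈ K | t ≤ w α}.Countable := by
  by_contra! h
  -- The cones with countable trace are dense here. All `w α` of height at least `γ` then lie in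
  -- such cones with roots below `γ`, of which there are countably many.
  obtain ⟨γ, hγ⟩ := hS.exists_level {t : S | {α ∈ K | t ≤ w α}.Countable}
  refine hK ?_
  have h1 : {α | (w α).1.ht < γ}.Countable := (hS.countable_ht_lt γ).preimage hw
  have h2 : (⋃ u ∈ {u : S | u.1.ht < γ ∧ {α ∈ K | u ≤ w α}.Countable},
      {α ∈ K | u ≤ w α}).Countable :=
    ((hS.countable_ht_lt γ).mono fun u hu => hu.1).biUnion fun u hu => hu.2
  refine (h1.union h2).mono fun α hα => ?_
  rcases lt_or_ge (w α).1.ht γ with hlt | hge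
  · exact Or.inl hlt
  · right
    rcases hγ _ hge with ⟨u, hu, hu1, hu2⟩ | hno
    · exact Set.mem_biUnion (show u ∈ _ from ⟨hu2, hu⟩) ⟨hα, hu1⟩
    · obtain ⟨t, ht, ht'⟩ := h (w α)
      exact absurd ht (hno t ht')

/-- Some member of an uncountable set of nodes has infinitely many predecessors in the set. -/
theorem exists_infinite_below {W : Set S} (hW : ¬ W.Countable) :
    ∃ w ∈ W, {v ∈ W | v < w}.Infinite := by
  by_contra! h
  suffices hA : ∀ n : ℕ, {w ∈ W | {v ∈ W | v < w}.ncard = n}.Countable by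
    have hsub : W ⊆ ⋃ n : ℕ, {w ∈ W | {v ∈ W | v < w}.ncard = n} := fun w hw =>
      Set.mem_iUnion.2 ⟨_, hw, rfl⟩
    exact hW ((Set.countable_iUnion hA).mono hsub)
  -- Comparable members of `W` have different finite numbers of predecessors in `W`.
  refine fun n => hS.countable_of_antichain ?_
  rintro v ⟨hv, hvn⟩ w ⟨hw, hwn⟩ hne hle
  have hlt := lt_of_le_of_ne hle hne
  refine (Set.ncard_lt_ncard (s := {x ∈ W | x < v}) (t := {x ∈ W | x < w}) ?_ (h w hw)).ne
    (hvn.trans hwn.symm)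
  exact ⟨fun x hx => ⟨hx.1, hx.2.trans hlt⟩, fun hsub => lt_irrefl v (hsub ⟨hv, hlt⟩).2⟩

end IsCompleteCoherentSuslin

end SuslinPFA
end

noncomputable section

namespace SuslinPFA

/-! ### Hulls -/

section Hull

variable {X Y : Type}

/-- The least set that includes `A` and is closed under `op`. -/
def Hull (op : Finset X → Set X) (A : Set X) : Set X :=
  ⋂₀ {H | A ⊆ H ∧ ∀ a : Finset X, ↑a ⊆ H → op a ⊆ H}

variable {op : Finset X → Set X}

theorem subset_hull (A : Set X) : A ⊆ Hull op A := Set.subset_sInter fun _ hH => hH.1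

theorem hull_closed (A : Set X) {a : Finset X} (ha : ↑a ⊆ Hull op A) : op a ⊆ Hull op A :=
  Set.subset_sInter fun _ hH => hH.2 a (ha.trans (Set.sInter_subset_of_mem hH))

theorem hull_subset {A H : Set X} (hA : A ⊆ H) (hH : ∀ a : Finset X, ↑a ⊆ H → op a ⊆ H) :
    Hull op A ⊆ H := Set.sInter_subset_of_mem ⟨hA, hH⟩

theorem hull_mono {A B : Set X} (h : A ⊆ B) : Hull op A ⊆ Hull op B :=
  hull_subset (h.trans (subset_hull B)) fun _ ha => hull_closed B ha

theorem exists_subset_of_finset_subset_iUnion {H : ℕ → Set X} (hH : Monotone H) (a : Finset X)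
    (ha : ↑a ⊆ ⋃ n, H n) : ∃ n, ↑a ⊆ H n :=
  hH.directed_le.exists_mem_subset_of_finset_subset_biUnion ha

theorem hull_countable (hop : ∀ a, (op a).Countable) {A : Set X} (hA : A.Countable) :
    (Hull op A).Countable := by
  let H : ℕ → Set X := fun n => Nat.rec A (fun _ B => B ∪ ⋃ a ∈ {a : Finset X | ↑a ⊆ B}, op a) n
  have hs : ∀ n, H (n + 1) = H n ∪ ⋃ a ∈ {a : Finset X | ↑a ⊆ H n}, op a := fun n => rfl
  have hm : Monotone H := monotone_nat_of_le_succ fun n => by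
    rw [hs]
    exact Set.subset_union_left
  have hc : ∀ n, (H n).Countable := by
    intro n
    induction n with
    | zero => exact hA
    | succ n ih =>
      rw [hs]
      have hfin : {a : Finset X | ↑a ⊆ H n}.Countable :=
        ((Set.countable_ofPred_finite_subset ih).preimage Finset.coe_injective).mono
          fun a ha => show (a : Set X) ∈ {t : Set X | t.Finite ∧ t ⊆ H n} from
            ⟨a.finite_toSet, ha⟩
      exact ih.union (hfin.biUnion fun a _ => hop a)
  refine (Set.countable_iUnion hc).mono (hull_subset (Set.subset_iUnion H 0) fun a ha => ?_)
  obtain ⟨n, hn⟩ := exists_subset_of_finset_subset_iUnion hm a ha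
  refine Set.Subset.trans ?_ (Set.subset_iUnion H (n + 1))
  rw [hs]
  exact (Set.subset_biUnion_of_mem (u := op) (show a ∈ {a : Finset X | ↑a ⊆ H n} from hn)).trans
    Set.subset_union_right

/-- The sets that are traces of hulls form a closed unbounded collection. -/
theorem isClub_hull (hop : ∀ a, (op a).Countable) {ι : Y → X} (hι : Function.Injective ι) :
    IsClub {M : Set Y | M.Countable ∧ ι ⁻¹' Hull op (ι '' M) = M} where
  countable M hM := hM.1
  unbounded M hM := by
    have hsub : M ⊆ ι ⁻¹' Hull op (ι '' M) := fun x hx => subset_hull _ ⟨x, hx, rfl⟩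
    refine ⟨ι ⁻¹' Hull op (ι '' M), ⟨(hull_countable hop (hM.image ι)).preimage hι, ?_⟩, hsub⟩
    refine Set.Subset.antisymm (Set.preimage_mono ?_) fun x hx => subset_hull _ ⟨x, hx, rfl⟩
    exact hull_subset (Set.image_preimage_subset _ _) fun a ha => hull_closed _ ha
  closed M hM hMC := by
    refine ⟨Set.countable_iUnion fun k => (hMC k).1, Set.Subset.antisymm (fun x hx => ?_)
      fun x hx => subset_hull _ ⟨x, hx, rfl⟩⟩
    have hmono : Monotone fun k => Hull op (ι '' M k) := fun i j hij =>
      hull_mono (Set.image_mono (hM hij))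
    have h : Hull op (ι '' ⋃ k, M k) ⊆ ⋃ k, Hull op (ι '' M k) := by
      refine hull_subset ?_ fun a ha => ?_
      · rw [Set.image_iUnion]
        exact Set.iUnion_mono fun k => subset_hull _
      · obtain ⟨n, hn⟩ := exists_subset_of_finset_subset_iUnion hmono a ha
        exact (hull_closed _ hn).trans (Set.subset_iUnion (fun k => Hull op (ι '' M k)) n)
    obtain ⟨k, hk⟩ := Set.mem_iUnion.1 (h hx)
    exact Set.mem_iUnion.2 ⟨k, by rw [← (hMC k).2]; exact hk⟩

end Hull

/-! ### Largeness of names -/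

section Large

variable {S : Set Node} (E : Omega1 → Omega1 → Prop)

/-- Here `X` is an `S`-name for a set of ordinals, `s ∈ X α` meaning that `s` forces `α` into it.
The node `t` is in `Large E X` when for each finite `B`, some ordinal that is forced into the set
by a proper restriction of `t` is `E`-related to the larger members of `B`. -/
def Large (X : Omega1 → Set S) : Set S :=
  {t | ∀ B : Finset Omega1, ∃ α < t.1.ht, (∃ s < t, s ∈ X α) ∧ ∀ β ∈ B, α < β → E α β}

/-- `S`-names for sets of finite sets of ordinals. -/
abbrev FinName (S : Set Node) : Type := Finset Omega1 → Set S

/-- The name for `{y | a ∪ y ∈ T}`. -/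
def FinName.sec (T : FinName S) (a : Finset Omega1) : FinName S := fun y => T (a ∪ y)

/-- The nodes that force `T` to be large in the sense of `n` nested quantifiers. -/
def LargeN : ℕ → FinName S → Set S
  | 0, T => T ∅
  | n + 1, T => Large E fun α => LargeN n (T.sec {α})

/-- The name for the set of those `y` for which the section of `T` at `y` is large. -/
def FinName.low (T : FinName S) (n : ℕ) : FinName S := fun y => LargeN E n (T.sec y)

theorem FinName.sec_sec (T : FinName S) (a b : Finset Omega1) :
    (T.sec a).sec b = T.sec (a ∪ b) := by
  funext y
  simp only [FinName.sec, Finset.union_assoc]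

theorem FinName.sec_empty (T : FinName S) : T.sec ∅ = T := by
  funext y
  simp only [FinName.sec, Finset.empty_union]

/-- Iterated largeness is associative, as for iterated quantifiers. This lets genericity over two
successive models be composed when conditions are amalgamated. -/
theorem largeN_low (k n : ℕ) (T : FinName S) : LargeN E k (T.low E n) = LargeN E (k + n) T := by
  induction k generalizing T with
  | zero =>
    rw [Nat.zero_add]
    change LargeN E n (T.sec ∅) = _
    rw [T.sec_empty]
  | succ k ih =>
    rw [Nat.succ_add]
    change Large E (fun α => LargeN E k ((T.low E n).sec {α})) = Large E _
    congr 1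
    funext α
    rw [← ih]
    congr 1
    funext y
    change LargeN E n (T.sec ({α} ∪ y)) = LargeN E n ((T.sec {α}).sec y)
    rw [T.sec_sec]

/-- A large name can be met below any node forcing this, `E`-related to a given finite set. -/
theorem exists_of_mem_largeN (n : ℕ) (T : FinName S) {t : S} (ht : t ∈ LargeN E n T)
    (B : Finset Omega1) : ∃ l : Finset Omega1, (∀ α ∈ l, α < t.1.ht) ∧ (∃ s ≤ t, s ∈ T l) ∧
      ∀ α ∈ l, ∀ β ∈ B, α < β → E α β := by
  induction n generalizing T t with
  | zero => exact ⟨∅, by simp, ⟨t, le_rfl, ht⟩, by simp⟩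
  | succ n ih =>
    obtain ⟨α, hα, ⟨s, hst, hs⟩, hE⟩ := ht B
    obtain ⟨l, hl1, ⟨u, hu, hul⟩, hl3⟩ := ih _ hs
    refine ⟨{α} ∪ l, fun β hβ => ?_, ⟨u, hu.trans hst.le, hul⟩, fun β hβ => ?_⟩
    · rcases Finset.mem_union.1 hβ with h | h
      · rwa [Finset.mem_singleton.1 h]
      · exact (hl1 β h).trans (Node.ht_strictMono hst)
    · rcases Finset.mem_union.1 hβ with h | h
      · rwa [Finset.mem_singleton.1 h]
      · exact hl3 β h

end Large

end SuslinPFA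
end

noncomputable section

namespace SuslinPFA

/-! ### Models as side conditions -/

/-- Codes of the objects that a model may contain. -/
inductive Code (S : Set Node) : Type
  | ord (α : Omega1)
  | node (s : S)
  | name (T : FinName S)
  | model (δ : Omega1) (e : ℕ → Code S)

/-- A countable collection of codes, with a countable ordinal as its height. -/
@[ext]
structure Model (S : Set Node) : Type where
  height : Omega1
  elts : ℕ → Code S

namespace Model

variable {S : Set Node}

/-- The code of a model. -/
def code (m : Model S) : Code S := Code.model m.height m.elts

theorem code_injective : Function.Injective (code (S := S)) := by
  rintro ⟨a, e⟩ ⟨b, f⟩ h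
  injection h with h1 h2
  exact Model.ext h1 h2

/-- The elements of a model. -/
def carrier (m : Model S) : Set (Code S) := Set.range m.elts

variable (E : Omega1 → Omega1 → Prop)

/-- The closure properties of the models that are used as side conditions. -/
structure Closed (m : Model S) : Prop where
  mem_mono : ∀ m' : Model S, m'.code ∈ m.carrier →
    m'.carrier ⊆ m.carrier ∧ m'.height ≤ m.height
  sec : ∀ T, Code.name T ∈ m.carrier → ∀ α < m.height, Code.name (T.sec {α}) ∈ m.carrier
  low : ∀ T, Code.name T ∈ m.carrier → ∀ n, Code.name (T.low E n) ∈ m.carrier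

variable {E} in
theorem Closed.sec_finset {m : Model S} (hm : m.Closed E) {T : FinName S}
    (hT : Code.name T ∈ m.carrier) {a : Finset Omega1} (ha : ∀ α ∈ a, α < m.height) :
    Code.name (T.sec a) ∈ m.carrier := by
  classical
  induction a using Finset.induction_on generalizing T with
  | empty => rwa [T.sec_empty]
  | insert α a _ ih =>
    rw [Finset.insert_eq, ← T.sec_sec]
    exact ih (hm.sec T hT α (ha α (Finset.mem_insert_self _ _)))
      fun β hβ => ha β (Finset.mem_insert_of_mem hβ)

/-- The finite set `y` is generic over `m`: each name in `m` into which `y` may be forced can be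
forced to be large. -/
def Generic (m : Model S) (y : Finset Omega1) : Prop :=
  ∀ T, Code.name T ∈ m.carrier → ∀ t ∈ T y, ∃ t', t ≤ t' ∧ t' ∈ LargeN E y.card T

end Model

/-! ### The poset -/

/-- The conditions: a finite set of ordinals that is homogeneous for `E`, with a finite
`∈`-chain of models over which its end segments are generic. -/
@[ext]
structure Cond (S : Set Node) (E : Omega1 → Omega1 → Prop) : Type where
  pts : Finset Omega1
  models : Finset (Model S)
  hom : ∀ α ∈ pts, ∀ β ∈ pts, α < β → E α β
  closed : ∀ m ∈ models, m.Closed E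
  chain : ∀ m ∈ models, ∀ m' ∈ models, m = m' ∨ m.code ∈ m'.carrier ∨ m'.code ∈ m.carrier
  generic : ∀ m ∈ models, m.Generic E (pts.filter (m.height ≤ ·))

namespace Cond

variable {S : Set Node} {E : Omega1 → Omega1 → Prop}

instance : PartialOrder (Cond S E) where
  le p q := q.pts ⊆ p.pts ∧ q.models ⊆ p.models
  le_refl p := ⟨subset_rfl, subset_rfl⟩
  le_trans p q r h h' := ⟨h'.1.trans h.1, h'.2.trans h.2⟩
  le_antisymm p q h h' := Cond.ext (h'.1.antisymm h.1) (h'.2.antisymm h.2)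

instance : Nonempty (Cond S E) := ⟨⟨∅, ∅, by simp, by simp, by simp, by simp⟩⟩

/-- The amalgamation of a condition `r` that contains the model `m` with a condition `r'` that
lies in `m` and includes the part of `r` in `m`. -/
theorem exists_le_le {r r' : Cond S E} {m : Model S} (hm : m ∈ r.models)
    (h1 : ∀ α ∈ r'.pts, α < m.height) (h2 : ∀ m' ∈ r'.models, m'.code ∈ m.carrier)
    (h3 : ∀ α ∈ r.pts, α < m.height → α ∈ r'.pts)
    (h4 : ∀ m' ∈ r.models, m'.code ∈ m.carrier → m' ∈ r'.models)
    (h5 : ∀ α ∈ r'.pts, ∀ β ∈ r.pts, m.height ≤ β → E α β) : ∃ e, e ≤ r ∧ e ≤ r' := by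
  classical
  have hmc := r.closed m hm
  have key : ∀ m₁ ∈ r.models, m₁ ∈ r'.models ∨ m.carrier ⊆ m₁.carrier ∧ m.height ≤ m₁.height ∧
      ∀ m₂ ∈ r'.models, m₂.code ∈ m₁.carrier := by
    intro m₁ hm₁
    rcases r.chain m₁ hm₁ m hm with rfl | h | h
    · exact Or.inr ⟨subset_rfl, le_rfl, h2⟩
    · exact Or.inl (h4 m₁ hm₁ h)
    · obtain ⟨ha, hb⟩ := (r.closed m₁ hm₁).mem_mono m h
      exact Or.inr ⟨ha, hb, fun m₂ hm₂ => ha (h2 m₂ hm₂)⟩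
  have gen' : ∀ m' ∈ r'.models, m'.Generic E ((r.pts ∪ r'.pts).filter (m'.height ≤ ·)) := by
    intro m' hm' T hT t ht
    obtain ⟨hsub, hle⟩ := hmc.mem_mono m' (h2 m' hm')
    have heq : (r.pts ∪ r'.pts).filter (m'.height ≤ ·) =
        r'.pts.filter (m'.height ≤ ·) ∪ r.pts.filter (m.height ≤ ·) := by
      ext α
      simp only [Finset.mem_filter, Finset.mem_union]
      constructor
      · rintro ⟨h | h, h'⟩
        · rcases lt_or_ge α m.height with hlt | hge
          · exact Or.inl ⟨h3 α h hlt, h'⟩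
          · exact Or.inr ⟨h, hge⟩
        · exact Or.inl ⟨h, h'⟩
      · rintro (⟨h, h'⟩ | ⟨h, h'⟩)
        · exact ⟨Or.inr h, h'⟩
        · exact ⟨Or.inl h, hle.trans h'⟩
    have hdisj : Disjoint (r'.pts.filter (m'.height ≤ ·)) (r.pts.filter (m.height ≤ ·)) := by
      rw [Finset.disjoint_left]
      intro α ha hb
      exact absurd (h1 α (Finset.mem_filter.1 ha).1) (Finset.mem_filter.1 hb).2.not_gt
    rw [heq] at ht ⊢
    rw [Finset.card_union_of_disjoint hdisj]
    -- The end segment splits at `m.height`. Genericity over `m` makes the section of `T` at the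
    -- lower part large; this is a statement about `T.low`, which is in `m'`, so genericity over
    -- `m'` absorbs the lower part.
    obtain ⟨t', htt', ht'⟩ := r.generic m hm (T.sec (r'.pts.filter (m'.height ≤ ·)))
      (hmc.sec_finset (hsub hT) fun α hα => h1 α (Finset.mem_filter.1 hα).1) t ht
    obtain ⟨t'', htt'', ht''⟩ := r'.generic m' hm' _
      ((r'.closed m' hm').low T hT (r.pts.filter (m.height ≤ ·)).card) t' ht'
    rw [largeN_low] at ht''
    exact ⟨t'', htt'.trans htt'', ht''⟩
  refine ⟨⟨r.pts ∪ r'.pts, r.models ∪ r'.models, ?_, ?_, ?_, ?_⟩,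
    ⟨Finset.subset_union_left, Finset.subset_union_left⟩,
    ⟨Finset.subset_union_right, Finset.subset_union_right⟩⟩
  · have aux : ∀ α ∈ r.pts ∪ r'.pts, α < m.height → α ∈ r'.pts := fun α hα hlt =>
      (Finset.mem_union.1 hα).elim (fun h => h3 α h hlt) id
    intro α hα β hβ hlt
    rcases lt_or_ge β m.height with hβ' | hβ'
    · exact r'.hom α (aux α hα (hlt.trans hβ')) β (aux β hβ hβ') hlt
    · have hβr : β ∈ r.pts := (Finset.mem_union.1 hβ).elim id fun h =>
        absurd (h1 β h) hβ'.not_gt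
      rcases Finset.mem_union.1 hα with h | h
      · exact r.hom α h β hβr hlt
      · exact h5 α h β hβr hβ'
  · intro m₁ h
    exact (Finset.mem_union.1 h).elim (r.closed m₁) (r'.closed m₁)
  · intro m₁ h m₂ h'
    rcases Finset.mem_union.1 h with h | h <;> rcases Finset.mem_union.1 h' with h' | h'
    · exact r.chain _ h _ h'
    · rcases key m₁ h with hk | ⟨-, -, hk⟩
      · exact r'.chain _ hk _ h'
      · exact Or.inr (Or.inr (hk m₂ h'))
    · rcases key m₂ h' with hk | ⟨-, -, hk⟩
      · exact r'.chain _ h _ hk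
      · exact Or.inr (Or.inl (hk m₁ h))
    · exact r'.chain _ h _ h'
  · intro m₁ h
    rcases Finset.mem_union.1 h with h | h
    · rcases key m₁ h with hk | ⟨-, hk, -⟩
      · exact gen' m₁ hk
      · have heq : (r.pts ∪ r'.pts).filter (m₁.height ≤ ·) = r.pts.filter (m₁.height ≤ ·) := by
          ext α
          simp only [Finset.mem_filter, Finset.mem_union]
          exact ⟨fun ⟨h, h'⟩ => ⟨h.elim id fun h => absurd (h1 α h) (hk.trans h').not_gt, h'⟩,
            fun ⟨h, h'⟩ => ⟨Or.inl h, h'⟩⟩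
        rw [heq]
        exact r.generic m₁ h
    · exact gen' m₁ h

end Cond

/-! ### Elementary hulls -/

/-- The objects whose countable collections play the role of elementary submodels. -/
inductive Obj (S : Set Node) (E : Omega1 → Omega1 → Prop) : Type
  | cond (p : Cond S E)
  | rel (D : Set (Cond S E × S))
  | code (c : Code S)

namespace Obj

variable {S : Set Node} {E : Omega1 → Omega1 → Prop}

/-- The ordinal `α` as an object. -/
abbrev ord (α : Omega1) : Obj S E := .code (.ord α)

/-- The node `s` as an object. -/
abbrev node (s : S) : Obj S E := .code (.node s)

/-- The name `T` as an object. -/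
abbrev name (T : FinName S) : Obj S E := .code (.name T)

/-- The model `m` as an object. -/
abbrev model (m : Model S) : Obj S E := .code m.code

/-- An ordinal that bounds the ordinals which `p` allows, if there is one. -/
def bound (p : Cond S E) : Omega1 :=
  Classical.epsilon fun α => ∀ q ≤ p, ∀ β ∈ q.pts, β < α

/-- A height by which the set `U` of nodes is decided. -/
def level (U : Set S) : Omega1 :=
  Classical.epsilon fun γ => ∀ v : S, γ ≤ v.1.ht →
    (∃ u ∈ U, u ≤ v ∧ u.1.ht < γ) ∨ ∀ u ∈ U, ¬ v ≤ u

/-- The name for the finite sets `l` of ordinals that, added to the ordinals in `a`, give the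
ordinals of a condition which is in `D` and has all the models in `a`. -/
def trace (D : Set (Cond S E × S)) (a : Finset (Obj S E)) : FinName S := fun l =>
  {s | ∃ r : Cond S E, (r, s) ∈ D ∧ (∀ α, α ∈ r.pts ↔ ord α ∈ a ∨ α ∈ l) ∧
    ∀ m, model m ∈ a → m ∈ r.models}

/-- A condition in `D` that has the ordinals in `a` and all the models in `a`. -/
def witness (D : Set (Cond S E × S)) (a : Finset (Obj S E)) (s : S) : Cond S E :=
  Classical.epsilon fun r => (r, s) ∈ D ∧ (∀ α, α ∈ r.pts ↔ ord α ∈ a) ∧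
    ∀ m, model m ∈ a → m ∈ r.models

/-- The objects definable from one object. -/
def unary : Obj S E → Set (Obj S E)
  | .cond p => insert (ord (bound p)) (ord '' (p.pts : Set Omega1) ∪ model '' (p.models : Set _))
  | .rel _ => {ord (Classical.arbitrary _)}
  | .code (.ord α) => ord '' Set.Iic α ∪ node '' {s | s.1.ht ≤ α}
  | .code (.node _) => ∅
  | .code (.name T) => Set.range (fun n => name (T.low E n)) ∪
      Set.range fun n => ord (level (LargeN E n T))
  | .code (.model δ e) => insert (ord δ) (Set.range fun n => .code (e n))

/-- The objects definable from two objects and the finite set `a`. -/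
def binary (a : Finset (Obj S E)) : Obj S E → Obj S E → Set (Obj S E)
  | .code (.name T), .code (.ord α) => {name (T.sec {α})}
  | .rel D, .code (.node s) => {name (trace D a), .cond (witness D a s)}
  | _, _ => ∅

/-- The objects definable from the finite set `a` of objects. -/
def op (a : Finset (Obj S E)) : Set (Obj S E) :=
  (⋃ x ∈ (a : Set (Obj S E)), unary x) ∪
    ⋃ x ∈ (a : Set (Obj S E)), ⋃ y ∈ (a : Set (Obj S E)), binary a x y

theorem countable_op (hS : IsCompleteCoherentSuslin S) (a : Finset (Obj S E)) :
    (op a).Countable := by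
  refine (a.countable_toSet.biUnion fun x _ => ?_).union
    (a.countable_toSet.biUnion fun x _ => a.countable_toSet.biUnion fun y _ => ?_)
  · rcases x with p | D | α | s | T | ⟨δ, e⟩
    · exact (((p.pts.countable_toSet.image _).union (p.models.countable_toSet.image _)).insert _)
    · exact Set.countable_singleton _
    · refine ((Omega1.countable_Iic α).image _).union (Set.Countable.image ?_ _)
      obtain ⟨β, hβ⟩ := exists_gt α
      exact (hS.countable_ht_lt β).mono fun s hs => lt_of_le_of_lt hs hβ
    · exact Set.countable_empty
    · exact (Set.countable_range _).union (Set.countable_range _)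
    · exact (Set.countable_range _).insert _
  · unfold binary
    split
    · exact Set.countable_singleton _
    · exact (Set.countable_singleton _).insert _
    · exact Set.countable_empty

end Obj

end SuslinPFA
end

noncomputable section

namespace SuslinPFA

/-! ### Closed sets of objects, their models, and reflection -/

namespace Obj

variable {S : Set Node} {E : Omega1 → Omega1 → Prop}

/-- `H` is closed under definability. -/
def IsClosed (H : Set (Obj S E)) : Prop := ∀ a : Finset (Obj S E), ↑a ⊆ H → op a ⊆ H

namespace IsClosed

variable {H : Set (Obj S E)} (hH : IsClosed H)
include hH

theorem unary_subset {x : Obj S E} (hx : x ∈ H) : unary x ⊆ H := fun y hy =>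
  hH {x} (by simpa using hx) (Or.inl (Set.mem_biUnion (by simp) hy))

theorem binary_subset {a : Finset (Obj S E)} (ha : ↑a ⊆ H) {x y : Obj S E} (hx : x ∈ a)
    (hy : y ∈ a) : binary a x y ⊆ H := fun _ hz =>
  hH a ha (Or.inr (Set.mem_biUnion (Finset.mem_coe.2 hx)
    (Set.mem_biUnion (Finset.mem_coe.2 hy) hz)))

theorem ord_mem {p : Cond S E} (hp : .cond p ∈ H) {α : Omega1} (hα : α ∈ p.pts) : ord α ∈ H :=
  hH.unary_subset hp (Or.inr (Or.inl ⟨α, hα, rfl⟩))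

theorem model_mem {p : Cond S E} (hp : .cond p ∈ H) {m : Model S} (hm : m ∈ p.models) :
    model m ∈ H :=
  hH.unary_subset hp (Or.inr (Or.inr ⟨m, hm, rfl⟩))

theorem bound_mem {p : Cond S E} (hp : .cond p ∈ H) : ord (bound p) ∈ H :=
  hH.unary_subset hp (Or.inl rfl)

theorem ord_mem_of_le {α β : Omega1} (hα : ord α ∈ H) (h : β ≤ α) : ord β ∈ H :=
  hH.unary_subset hα (Or.inl ⟨β, h, rfl⟩)

theorem node_mem {α : Omega1} (hα : ord α ∈ H) {s : S} (h : s.1.ht ≤ α) : node s ∈ H :=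
  hH.unary_subset hα (Or.inr ⟨s, h, rfl⟩)

theorem low_mem {T : FinName S} (hT : name T ∈ H) (n : ℕ) : name (T.low E n) ∈ H :=
  hH.unary_subset hT (Or.inl ⟨n, rfl⟩)

theorem level_mem {T : FinName S} (hT : name T ∈ H) (n : ℕ) :
    ord (level (LargeN E n T)) ∈ H :=
  hH.unary_subset hT (Or.inr ⟨n, rfl⟩)

theorem height_mem {m : Model S} (hm : model m ∈ H) : ord m.height ∈ H :=
  hH.unary_subset hm (Or.inl rfl)

theorem elts_mem {m : Model S} (hm : model m ∈ H) {c : Code S} (hc : c ∈ m.carrier) :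
    .code c ∈ H := by
  obtain ⟨n, rfl⟩ := hc
  exact hH.unary_subset hm (Or.inr ⟨n, rfl⟩)

theorem sec_mem {T : FinName S} (hT : name T ∈ H) {α : Omega1} (hα : ord α ∈ H) :
    name (T.sec {α}) ∈ H := by
  classical
  refine hH.binary_subset (a := {name T, ord α}) ?_ (x := name T) (y := ord α)
    (by simp) (by simp) rfl
  rw [Finset.coe_pair]
  exact Set.insert_subset hT (Set.singleton_subset_iff.2 hα)

/-- Every kind of object except a node has an ordinal among the objects definable from it; for
relations an arbitrary ordinal was put in for this purpose. -/
theorem exists_ord_mem {x : Obj S E} (hx : x ∈ H) (hx' : ∀ s, x ≠ node s) :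
    ∃ α, ord α ∈ H := by
  rcases x with p | D | α | s | T | ⟨δ, e⟩
  · exact ⟨_, hH.bound_mem hx⟩
  · exact ⟨_, hH.unary_subset hx rfl⟩
  · exact ⟨α, hx⟩
  · exact absurd rfl (hx' s)
  · exact ⟨_, hH.level_mem hx 0⟩
  · exact ⟨δ, hH.unary_subset hx (Or.inl rfl)⟩

end IsClosed

/-- The model `m` consists of the codes in `H`. -/
structure IsModelOf (m : Model S) (H : Set (Obj S E)) : Prop where
  ord_mem_iff : ∀ α, ord α ∈ H ↔ α < m.height
  mem_iff : ∀ c, c ∈ m.carrier ↔ .code c ∈ H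

/-- The ordinals in `H` form an initial segment, so the least ordinal outside `H` serves as the
height. The object `x` guarantees that `H` contains an ordinal, hence that the set of codes to be
enumerated is nonempty. -/
theorem exists_isModelOf {H : Set (Obj S E)} (hH : IsClosed H) (hc : H.Countable)
    {x : Obj S E} (hx : x ∈ H) (hx' : ∀ s, x ≠ node s) : ∃ m : Model S, IsModelOf m H := by
  obtain ⟨α, hα⟩ := hH.exists_ord_mem hx hx'
  have hc' : (Obj.code ⁻¹' H).Countable := hc.preimage fun c c' h => by injection h
  obtain ⟨e, he⟩ := hc'.exists_eq_range ⟨.ord α, hα⟩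
  have hco : {α | ord α ∈ H}.Countable := hc.preimage fun c c' h => by
    injection h with h
    injection h
  obtain ⟨δ₀, hδ₀⟩ := Omega1.exists_gt_of_countable hco
  have hne : {δ | ord δ ∉ H}.Nonempty := ⟨δ₀, fun h => lt_irrefl _ (hδ₀ δ₀ h)⟩
  refine ⟨⟨wellFounded_lt.min _ hne, e⟩, fun β => ⟨fun hβ => ?_, fun hβ => ?_⟩, fun c => ?_⟩
  · by_contra hle
    exact wellFounded_lt.min_mem _ hne (hH.ord_mem_of_le hβ (not_lt.1 hle))
  · by_contra hno
    exact wellFounded_lt.not_lt_min (s := {δ | ord δ ∉ H}) hno hβ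
  · change c ∈ Set.range e ↔ _
    rw [← he]
    rfl

theorem IsModelOf.closed {H : Set (Obj S E)} (hH : IsClosed H) {m : Model S}
    (hm : IsModelOf m H) : m.Closed E where
  mem_mono m' hm' := by
    have h := (hm.mem_iff _).1 hm'
    exact ⟨fun c hc => (hm.mem_iff c).2 (hH.elts_mem h hc),
      ((hm.ord_mem_iff _).1 (hH.height_mem h)).le⟩
  sec T hT α hα := (hm.mem_iff _).2 (hH.sec_mem ((hm.mem_iff _).1 hT) ((hm.ord_mem_iff α).2 hα))
  low T hT n := (hm.mem_iff _).2 (hH.low_mem ((hm.mem_iff _).1 hT) n)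

/-- A model may be added on top of a condition. -/
theorem exists_cond_le {H : Set (Obj S E)} (hH : IsClosed H) {m : Model S} (hm : IsModelOf m H)
    {p : Cond S E} (hp : .cond p ∈ H) : ∃ q ≤ p, m ∈ q.models := by
  classical
  have hlt : ∀ α ∈ p.pts, α < m.height := fun α hα => (hm.ord_mem_iff α).1 (hH.ord_mem hp hα)
  have hin : ∀ m' ∈ p.models, m'.code ∈ m.carrier := fun m' hm' =>
    (hm.mem_iff _).2 (hH.model_mem hp hm')
  refine ⟨⟨p.pts, insert m p.models, p.hom, ?_, ?_, ?_⟩, ⟨subset_rfl, Finset.subset_insert _ _⟩,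
    Finset.mem_insert_self _ _⟩
  · intro m' h
    rcases Finset.mem_insert.1 h with rfl | h
    · exact hm.closed hH
    · exact p.closed m' h
  · intro m₁ h m₂ h'
    rcases Finset.mem_insert.1 h with h₁ | h₁ <;> rcases Finset.mem_insert.1 h' with h₂ | h₂
    · exact Or.inl (h₁.trans h₂.symm)
    · exact Or.inr (Or.inr (h₁ ▸ hin m₂ h₂))
    · exact Or.inr (Or.inl (h₂ ▸ hin m₁ h₁))
    · exact p.chain _ h₁ _ h₂
  · intro m' h
    rcases Finset.mem_insert.1 h with rfl | h
    · have : p.pts.filter (m'.height ≤ ·) = ∅ :=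
        Finset.filter_eq_empty_iff.2 fun α hα => (hlt α hα).not_ge
      rw [this]
      exact fun T _ t ht => ⟨t, le_rfl, ht⟩
    · exact p.generic m' h

/-- The reflection property of the poset. -/
theorem reflect (hS : IsCompleteCoherentSuslin S) {H : Set (Obj S E)} (hH : IsClosed H)
    {m : Model S} (hm : IsModelOf m H) {r : Cond S E} (hr : m ∈ r.models)
    {D : Set (Cond S E × S)} (hD : .rel D ∈ H) {t : S} (ht : m.height ≤ t.1.ht)
    (hrt : (r, t) ∈ D) :
    ∃ r' s', (r', s') ∈ D ∧ .cond r' ∈ H ∧ s' < t ∧ ∃ e, e ≤ r ∧ e ≤ r' := by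
  classical
  let x₀ := r.pts.filter (· < m.height)
  let M₀ := r.models.filter (·.code ∈ m.carrier)
  have hx₀ : ∀ α ∈ x₀, ord α ∈ H := fun α hα =>
    (hm.ord_mem_iff α).2 (Finset.mem_filter.1 hα).2
  have hM₀ : ∀ m' ∈ M₀, model m' ∈ H := fun m' hm' =>
    (hm.mem_iff _).1 (Finset.mem_filter.1 hm').2
  let a : S → Finset Omega1 → Finset (Obj S E) := fun s x =>
    {.rel D, node s} ∪ (x.image ord ∪ M₀.image model)
  have ha : ∀ s x, node s ∈ H → (∀ α ∈ x, ord α ∈ H) → ↑(a s x) ⊆ H := by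
    intro s x hs hx y hy
    simp only [a, Finset.coe_union, Finset.coe_insert, Finset.coe_singleton, Finset.coe_image,
      Set.mem_union, Set.mem_insert_iff, Set.mem_singleton_iff, Set.mem_image] at hy
    rcases hy with (rfl | rfl) | ⟨α, hα, rfl⟩ | ⟨m', hm', rfl⟩
    · exact hD
    · exact hs
    · exact hx α hα
    · exact hM₀ m' hm'
  have hao : ∀ s x α, ord α ∈ a s x ↔ α ∈ x := by
    intro s x α
    simp [a, ord, node, model, Model.code]
  have ham : ∀ s x m', model m' ∈ a s x ↔ m' ∈ M₀ := by
    intro s x m'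
    have : ∀ m₁ : Model S, m₁.code = m'.code ↔ m₁ = m' := fun m₁ => Model.code_injective.eq_iff
    simp [a, ord, node, model, this]
    simp [Model.code]
  have hbin : ∀ s x, node s ∈ H → (∀ α ∈ x, ord α ∈ H) →
      name (trace D (a s x)) ∈ H ∧ .cond (witness D (a s x) s) ∈ H := by
    intro s x hs hx
    have h := hH.binary_subset (ha s x hs hx) (x := .rel D) (y := node s)
      (by simp [a]) (by simp [a])
    exact ⟨h (Or.inl rfl), h (Or.inr rfl)⟩
  obtain ⟨α₀, hα₀⟩ := hH.exists_ord_mem hD (by simp)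
  have hα₀' := (hm.ord_mem_iff α₀).1 hα₀
  -- The node `s₀` is a dummy: `binary` produces `trace D a` only in the presence of a node, on
  -- which the trace does not depend.
  obtain ⟨s₀, -, hs₀⟩ := hS.exists_restr t (hα₀'.le.trans ht)
  have hT := (hbin s₀ x₀ (hH.node_mem hα₀ hs₀.le) hx₀).1
  set T := trace D (a s₀ x₀) with hTdef
  have htT : t ∈ T (r.pts.filter (m.height ≤ ·)) := by
    refine ⟨r, hrt, fun α => ?_, fun m' hm' => (Finset.mem_filter.1 ((ham _ _ _).1 hm')).1⟩
    rw [hao, Finset.mem_filter, Finset.mem_filter, ← and_or_left]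
    exact ⟨fun h => ⟨h, lt_or_ge _ _⟩, fun h => h.1⟩
  -- Genericity makes `T` large at some `t' ≥ t`. The height deciding this largeness lies in `H`, so
  -- it is below `m.height ≤ t.1.ht`, and largeness already holds at some `u ≤ t` of smaller height.
  obtain ⟨t', htt', ht'⟩ := r.generic m hr T ((hm.mem_iff _).2 hT) t htT
  have hlev := hH.level_mem hT (r.pts.filter (m.height ≤ ·)).card
  have hlevδ := (hm.ord_mem_iff _).1 hlev
  obtain ⟨u, huU, hut, hul⟩ := (Classical.epsilon_spec (hS.exists_level
    (LargeN E (r.pts.filter (m.height ≤ ·)).card T)) t (hlevδ.le.trans ht)).resolve_right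
      fun h => h t' ht' htt'
  -- Testing largeness against `r.pts` makes the new points `E`-related to the points of `r` above
  -- them, as amalgamation requires.
  obtain ⟨l, hl1, ⟨s, hsu, hsT⟩, hl3⟩ := exists_of_mem_largeN E _ _ huU r.pts
  have hlH : ∀ α ∈ x₀ ∪ l, ord α ∈ H := fun α hα => (Finset.mem_union.1 hα).elim (hx₀ α)
    fun h => hH.ord_mem_of_le hlev ((hl1 α h).trans hul).le
  have hsl := (Node.ht_mono hsu).trans_lt hul
  have hsH : node s ∈ H := hH.node_mem hlev hsl.le
  have hwH := (hbin s (x₀ ∪ l) hsH hlH).2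
  have hw : ∃ r' : Cond S E, (r', s) ∈ D ∧ (∀ α, α ∈ r'.pts ↔ ord α ∈ a s (x₀ ∪ l)) ∧
      ∀ m, model m ∈ a s (x₀ ∪ l) → m ∈ r'.models := by
    obtain ⟨r', h1, h2, h3⟩ := hsT
    refine ⟨r', h1, fun α => ?_, fun m' hm' => h3 m' ?_⟩
    · rw [h2, hao, hao, Finset.mem_union]
    · rwa [ham] at hm' ⊢
  obtain ⟨h1, h2, h3⟩ := Classical.epsilon_spec hw
  change (witness D (a s (x₀ ∪ l)) s, s) ∈ D at h1
  set r' := witness D (a s (x₀ ∪ l)) s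
  refine ⟨r', s, h1, hwH, lt_of_le_of_ne (hsu.trans hut) fun h => ?_,
    Cond.exists_le_le hr (fun α hα => (hm.ord_mem_iff α).1 (hH.ord_mem hwH hα))
      (fun m' hm' => (hm.mem_iff _).2 (hH.model_mem hwH hm'))
      (fun α hα hlt => (h2 α).2 ((hao _ _ _).2 (Finset.mem_union_left _
        (Finset.mem_filter.2 ⟨hα, hlt⟩))))
      (fun m' hm' hin => h3 m' ((ham _ _ _).2 (Finset.mem_filter.2 ⟨hm', hin⟩))) ?_⟩
  · rw [h] at hsl
    exact (hsl.trans hlevδ).not_ge ht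
  · intro α hα β hβ hle
    have hlt : α < β := ((hm.ord_mem_iff α).1 (hH.ord_mem hwH hα)).trans_le hle
    rcases Finset.mem_union.1 ((hao _ _ _).1 ((h2 α).1 hα)) with h | h
    · exact r.hom α (Finset.mem_filter.1 h).1 β hβ hlt
    · exact hl3 α h β hβ hlt

end Obj

end SuslinPFA
end

noncomputable section

namespace SuslinPFA

/-! ### Posets with the reflection property force the tree to be Suslin -/

section Forcing

variable {P X : Type} [PartialOrder P]

theorem ForcesMem.mono {p q : P} {x : X} {A : Name P X} (h : ForcesMem p x A) (hq : q ≤ p) :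
    ForcesMem q x A := fun r hr => h r (hr.trans hq)

theorem forcesCountable_of_countable [Nonempty X] {q : P} {A : Name P X} {C : Set X}
    (hC : C.Countable) (h : ∀ r ≤ q, ∀ x, ForcesMem r x A → x ∈ C) : ForcesCountable q A := by
  obtain ⟨g, hg⟩ := (hC.insert (Classical.arbitrary X)).exists_eq_range (Set.insert_nonempty _ _)
  refine ⟨{z | z.1.2 = g z.1.1}, fun r _ k x y hx hy => ?_, fun r hr x hx => ?_⟩
  · obtain ⟨_, _, _, hx', _⟩ := hx r le_rfl
    obtain ⟨_, _, _, hy', _⟩ := hy r le_rfl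
    exact Eq.trans hx' (Eq.symm hy')
  · have hxg : x ∈ Set.range g := hg ▸ Set.mem_insert_of_mem _ (h r hr x hx)
    obtain ⟨k, rfl⟩ := hxg
    exact ⟨r, le_rfl, k, fun r' _ => ⟨r', le_rfl, r', rfl, le_rfl⟩⟩

/-- Each condition has an extension `q`, with a countable height `δ`, such that if a relation `D k`
between conditions below `q` and nodes has an instance `(r, t)` with `t` of height at least `δ`,
then it has another one whose condition is compatible with `r` and whose node is below `t`. -/
def Reflecting (P : Type) [PartialOrder P] (S : Set Node) : Prop :=
  ∀ (p : P) (D : ℕ → Set (P × S)), ∃ q ≤ p, ∃ δ : Omega1, ∀ r ≤ q, ∀ k, ∀ t : S,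
    δ ≤ t.1.ht → (r, t) ∈ D k → ∃ r' s', (r', s') ∈ D k ∧ s' < t ∧ ∃ e, e ≤ r ∧ e ≤ r'

/-- A name for an enumeration of `S` would assign the same index to a node and, by reflection, to a
smaller one. A high node forced into an antichain reflects to a smaller node forced into it. For
chains, what is reflected is a node that leaves the chain at its last place. -/
theorem Reflecting.forcesSuslin {S : Set Node} (hP : Reflecting P S)
    (hS : IsCompleteCoherentSuslin S) : ForcesSuslin P S := by
  have : Nonempty S := ⟨(hS.exists_ht_ge (Classical.arbitrary _)).choose⟩
  refine ⟨fun p q _ hq => ?_, fun p A hA => ⟨fun hanti => ?_, fun hchain => ?_⟩⟩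
  · obtain ⟨f, hf1, hf2⟩ := hq
    obtain ⟨q', hq', δ, hδ⟩ := hP q fun k => {z | ForcesMem z.1 (k, z.2) f}
    obtain ⟨x, hx⟩ := hS.exists_ht_ge δ
    obtain ⟨r, hr, k, hk⟩ := hf2 q' hq' x fun r _ => ⟨r, le_rfl, r, trivial, le_rfl⟩
    obtain ⟨r', s', hs', hlt, e, her, her'⟩ := hδ r hr k x hx hk
    exact hlt.ne (hf1 e (her.trans (hr.trans hq')) k s' x (ForcesMem.mono hs' her')
      (ForcesMem.mono hk her))
  · obtain ⟨q, hq, δ, hδ⟩ := hP p fun _ => {z | ForcesMem z.1 z.2 A}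
    refine hA q hq (forcesCountable_of_countable (hS.countable_ht_lt δ) fun r hr x hx => ?_)
    by_contra hge
    obtain ⟨r', s', hs', hlt, e, her, her'⟩ := hδ r hr 0 x (not_lt.1 hge) hx
    exact hanti e (her.trans (hr.trans hq)) s' x (ForcesMem.mono hs' her')
      (ForcesMem.mono hx her) hlt.ne hlt.le
  · obtain ⟨q, hq, δ, hδ⟩ := hP p fun _ => {z | ∃ u : S, ∃ ξ < u.1.ht, ForcesMem z.1 u A ∧
      z.2.1.ht = Order.succ ξ ∧ z.2.1.app ξ ≠ u.1.app ξ}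
    obtain ⟨γ, hγ⟩ := exists_gt δ
    refine hA q hq (forcesCountable_of_countable (hS.countable_ht_lt γ) fun r hr u hu => ?_)
    by_contra hge
    have hδu : δ < u.1.ht := hγ.trans_le (not_lt.1 hge)
    obtain ⟨s, hs, hsht⟩ := hS.exists_restr
      ⟨u.1.flip {δ}, hS.flip_mem u.2 (Set.finite_singleton δ)⟩ (Order.succ_le_of_lt hδu)
    have happ : ∀ ξ ≤ δ, s.1.app ξ = (u.1.flip {δ}).app ξ := fun ξ hξ =>
      (Node.le_iff.1 hs).2 ξ (by rw [hsht]; exact Order.lt_succ_of_le hξ)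
    obtain ⟨r', s', ⟨u', ξ, hξ, hu', hs'ht, hs'⟩, hlt, e, her, her'⟩ := hδ r hr 0 s
      (by rw [hsht]; exact Order.le_succ δ) ⟨u, δ, hδu, hu, hsht, by
        rw [happ δ le_rfl, Node.app_flip_of_mem hδu (Set.mem_singleton _)]
        exact Node.one_sub_ne _⟩
    have hξδ : ξ < δ := by
      have h := IsCompleteCoherentSuslin.ht_strictMono hlt
      rw [hs'ht, hsht] at h
      exact Order.succ_lt_succ_iff.1 h
    have hval : s'.1.app ξ = u.1.app ξ := by
      rw [(Node.le_iff.1 hlt.le).2 ξ (by rw [hs'ht]; exact Order.lt_succ ξ), happ ξ hξδ.le,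
        Node.app_flip_of_notMem (hξδ.trans hδu) (by simpa using hξδ.ne)]
    rw [hval] at hs'
    rcases hchain e (her.trans (hr.trans hq)) u u' (ForcesMem.mono hu her)
      (ForcesMem.mono hu' her') with h | h
    · exact hs' ((Node.le_iff.1 h).2 ξ (hξδ.trans hδu))
    · exact hs' ((Node.le_iff.1 h).2 ξ hξ).symm

end Forcing

/-! ### The dichotomy -/

section Dichotomy

variable {S : Set Node} {E : Omega1 → Omega1 → Prop}

open Obj

theorem isClosed_hull (A : Set (Obj S E)) : IsClosed (Hull op A) := fun _ ha => hull_closed A ha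

/-- The conditions below `q₀` form a proper poset. -/
theorem isProper_below (hS : IsCompleteCoherentSuslin S) (q₀ : Cond S E) :
    IsProper {p : Cond S E // p ≤ q₀} := by
  -- A set of conditions is coded by a relation that ignores the node coordinate; since `S` is
  -- nonempty, the coding is injective.
  let ι : {p : Cond S E // p ≤ q₀} ⊕ Set {p : Cond S E // p ≤ q₀} → Obj S E := fun z =>
    Sum.elim (fun p => .cond p.1) (fun D => .rel {z | ∃ h : z.1 ≤ q₀, ⟨z.1, h⟩ ∈ D}) z
  have hι : Function.Injective ι := by
    obtain ⟨s, -⟩ := hS.exists_ht_ge (Classical.arbitrary _)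
    rintro (p | D) (p' | D') h
    · injection h with h
      rw [Subtype.ext h]
    · cases h
    · cases h
    · injection h with h
      congr 1
      ext d
      have hd := Set.ext_iff.1 h (d.1, s)
      exact ⟨fun hdD => (hd.1 ⟨d.2, hdD⟩).2, fun hdD => (hd.2 ⟨d.2, hdD⟩).2⟩
  refine ⟨_, isClub_hull (countable_op hS) hι, fun M hM p hp => ?_⟩
  have hsub : ι '' M ⊆ Hull op (ι '' M) := subset_hull _
  have hpH : .cond p.1 ∈ Hull op (ι '' M) := hsub ⟨_, hp, rfl⟩
  obtain ⟨m, hm⟩ := exists_isModelOf (isClosed_hull _)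
    (hull_countable (countable_op hS) (hM.1.image ι)) hpH (by simp)
  obtain ⟨q, hqp, hmq⟩ := exists_cond_le (isClosed_hull _) hm hpH
  refine ⟨⟨q, hqp.trans p.2⟩, hqp, fun D hD hdense r hr => ?_⟩
  obtain ⟨r₁, hr₁, hr₁D⟩ := hdense r
  obtain ⟨t, ht⟩ := hS.exists_ht_ge m.height
  obtain ⟨r', _, ⟨h, hr'D⟩, hr'H, -, e, her, her'⟩ := reflect hS (isClosed_hull _) hm
    (r := r₁.1) ((hr₁.trans hr).2 hmq) (hsub ⟨_, hD, rfl⟩) ht ⟨r₁.2, hr₁D⟩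
  refine ⟨⟨r', h⟩, hr'D, ?_, ⟨e, her.trans r₁.2⟩, her', her.trans hr₁⟩
  rw [← hM.2]
  exact hr'H

/-- All the relations `D' k` go into one countable hull, and the model of this hull is added on top
of `p`. -/
theorem reflecting_below (hS : IsCompleteCoherentSuslin S) (q₀ : Cond S E) :
    Reflecting {p : Cond S E // p ≤ q₀} S := by
  intro p D
  let D' : ℕ → Set (Cond S E × S) := fun k => {z | ∃ h : z.1 ≤ q₀, (⟨z.1, h⟩, z.2) ∈ D k}
  let A : Set (Obj S E) := insert (.cond p.1) (Set.range fun k => .rel (D' k))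
  have hpH : .cond p.1 ∈ Hull op A := subset_hull _ (Set.mem_insert _ _)
  obtain ⟨m, hm⟩ := exists_isModelOf (isClosed_hull A)
    (hull_countable (countable_op hS) ((Set.countable_range _).insert _)) hpH (by simp)
  obtain ⟨q, hqp, hmq⟩ := exists_cond_le (isClosed_hull _) hm hpH
  refine ⟨⟨q, hqp.trans p.2⟩, hqp, m.height, fun r hr k t ht hrt => ?_⟩
  obtain ⟨r', s', ⟨h, hr'⟩, -, hlt, e, her, her'⟩ := reflect hS (isClosed_hull _) hm
    (r := r.1) (hr.2 hmq) (subset_hull _ (Set.mem_insert_of_mem _ ⟨k, rfl⟩)) (D := D' k) ht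
    ⟨r.2, hrt⟩
  exact ⟨⟨r', h⟩, s', hr', hlt, ⟨e, her.trans r.2⟩, her, her'⟩

/-- The second alternative of the dichotomy: an uncountable set of ordinals, with nodes forcing
them into a set that is nowhere large. -/
def HasSmallName (S : Set Node) (E : Omega1 → Omega1 → Prop) : Prop :=
  ∃ K : Set Omega1, ¬ K.Countable ∧ ∃ t : Omega1 → S, ∀ u : S, ∃ B : Finset Omega1,
    ∀ α ∈ K, α < u.1.ht → t α < u → ∃ β ∈ B, α < β ∧ ¬ E α β

/-- Otherwise each `b` above the height of `m` has a name in `m` and a node that refute genericity.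
As `m` is countable, one name serves uncountably many `b`, and its failure to be large above the
corresponding nodes is exactly a small name. -/
theorem exists_generic_singleton (h : ¬ HasSmallName S E) (m : Model S) :
    ∃ b, m.height ≤ b ∧ m.Generic E {b} := by
  by_contra! hno
  have h' : ∀ b, ∃ T : FinName S, ∃ t : S, m.height ≤ b →
      Code.name T ∈ m.carrier ∧ t ∈ T {b} ∧ ∀ t', t ≤ t' → t' ∉ LargeN E 1 T := by
    intro b
    by_cases hb : m.height ≤ b
    · have := hno b hb
      unfold Model.Generic at this
      push Not at this
      obtain ⟨T, hT, t, ht, hlarge⟩ := this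
      exact ⟨T, t, fun _ => ⟨hT, ht, by simpa using hlarge⟩⟩
    · obtain ⟨t⟩ : Nonempty S := by
        obtain ⟨b', hb'⟩ := exists_gt (max b m.height)
        have := hno b' ((le_max_right _ _).trans hb'.le)
        unfold Model.Generic at this
        push Not at this
        obtain ⟨-, -, t, -⟩ := this
        exact ⟨t⟩
      exact ⟨fun _ => ∅, t, fun h => absurd h hb⟩
  choose T t hTt using h'
  obtain ⟨n, hn⟩ : ∃ n, ¬ {b | m.height ≤ b ∧ m.elts n = Code.name (T b)}.Countable := by
    by_contra! hcount
    refine Omega1.not_countable_of_unbounded (s := {b | m.height ≤ b}) (fun a =>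
      ⟨max a m.height, show m.height ≤ _ from le_max_right _ _, le_max_left _ _⟩)
      ((Set.countable_iUnion hcount).mono fun b hb => ?_)
    obtain ⟨n, hn⟩ := (hTt b hb).1
    exact Set.mem_iUnion.2 ⟨n, hb, hn⟩
  refine h ⟨_, hn, t, fun u => ?_⟩
  by_cases hu : ∃ α, (m.height ≤ α ∧ m.elts n = Code.name (T α)) ∧ t α < u
  · obtain ⟨α₀, ⟨hα₀, hnα₀⟩, hlt⟩ := hu
    have hnot := (hTt α₀ hα₀).2.2 u hlt.le
    change ¬ ∀ B : Finset Omega1, _ at hnot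
    push Not at hnot
    obtain ⟨B, hB⟩ := hnot
    refine ⟨B, fun α hα hαu hαt => hB α hαu ⟨t α, hαt, ?_⟩⟩
    have heq : T α₀ = T α := by
      have := hnα₀.symm.trans hα.2
      injection this
    change t α ∈ T α₀ ({α} ∪ ∅)
    rw [heq, Finset.union_empty]
    exact (hTt α hα.1).2.1
  · push Not at hu
    exact ⟨∅, fun α hα _ hαt => absurd hαt (hu α hα)⟩

/-- Some condition forces the generic homogeneous set to be unbounded. -/
theorem exists_unbounded_cond (hS : IsCompleteCoherentSuslin S) (h : ¬ HasSmallName S E) :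
    ∃ q₀ : Cond S E, ∀ r ≤ q₀, ∀ α, ∃ q ≤ r, ∃ β ∈ q.pts, α ≤ β := by
  let D : Set (Cond S E × S) := {z | ∃ α, ∀ q ≤ z.1, ∀ β ∈ q.pts, β < α}
  have hD : .rel D ∈ Hull op {.rel D} := subset_hull _ rfl
  obtain ⟨m, hm⟩ := exists_isModelOf (isClosed_hull _)
    (hull_countable (countable_op hS) (Set.countable_singleton (.rel D))) hD (by simp)
  obtain ⟨b, hb, hgen⟩ := exists_generic_singleton h m
  refine ⟨⟨{b}, {m}, ?_, ?_, ?_, ?_⟩, fun r hr => ?_⟩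
  · intro α hα β hβ hlt
    rw [Finset.mem_singleton.1 hα, Finset.mem_singleton.1 hβ] at hlt
    exact absurd hlt (lt_irrefl _)
  · intro m' hm'
    rw [Finset.mem_singleton.1 hm']
    exact hm.closed (isClosed_hull _)
  · intro m₁ h₁ m₂ h₂
    exact Or.inl ((Finset.mem_singleton.1 h₁).trans (Finset.mem_singleton.1 h₂).symm)
  · intro m' hm'
    rw [Finset.mem_singleton.1 hm', Finset.filter_singleton, if_pos hb]
    exact hgen
  · by_contra! hα
    obtain ⟨t, ht⟩ := hS.exists_ht_ge m.height
    obtain ⟨r', _, hr'D, hr'H, -, e, her, her'⟩ := reflect hS (isClosed_hull _) hm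
      (hr.2 (Finset.mem_singleton_self m)) hD ht (show (r, t) ∈ D from hα)
    -- A bounded `r ≤ q₀` reflects to a bounded `r'` in the hull, whose bound is below `m.height ≤
    -- b`; yet a common extension contains `b`.
    have h1 := Classical.epsilon_spec hr'D e her' b
      ((her.trans hr).1 (Finset.mem_singleton_self b))
    have h2 := (hm.ord_mem_iff _).1 ((isClosed_hull _).bound_mem hr'H)
    exact (h1.trans h2).not_ge hb

/-- Under `PFA(S)`, there is an uncountable `E`-homogeneous set unless there is a small name. -/
theorem exists_homogeneous (hS : IsCompleteCoherentSuslin S) (hPFA : PFA S)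
    (h : ¬ HasSmallName S E) :
    ∃ Z : Set Omega1, ¬ Z.Countable ∧ ∀ α ∈ Z, ∀ β ∈ Z, α < β → E α β := by
  obtain ⟨q₀, hq₀⟩ := exists_unbounded_cond hS h
  have : Nonempty {p : Cond S E // p ≤ q₀} := ⟨⟨q₀, le_rfl⟩⟩
  obtain ⟨G, hG⟩ := hPFA {p : Cond S E // p ≤ q₀} (isProper_below hS q₀)
    ((reflecting_below hS q₀).forcesSuslin hS) (fun α => {p | ∃ β ∈ p.1.pts, α ≤ β})
    (fun α p => by
      obtain ⟨q, hq, hβ⟩ := hq₀ p.1 p.2 α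
      exact ⟨⟨q, hq.trans p.2⟩, hq, hβ⟩)
  refine ⟨{β | ∃ p ∈ G, β ∈ p.1.pts}, Omega1.not_countable_of_unbounded fun α => ?_, ?_⟩
  · obtain ⟨p, hp, β, hβ, hle⟩ := hG α
    exact ⟨β, ⟨p, hp, hβ⟩, hle⟩
  · rintro α ⟨p, hp, hα⟩ β ⟨p', hp', hβ⟩ hlt
    obtain ⟨r, -, hr, hr'⟩ := G.directed p hp p' hp'
    exact r.1.hom α (hr.1 hα) β (hr'.1 hβ) hlt

end Dichotomy

end SuslinPFA
end

noncomputable section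

namespace SuslinPFA

/-! ### Flipping a node at the height of a stem -/

namespace Node

theorem diff_eq_singleton {u v : Node} {ξ : Omega1} (hξ : ξ < u.ht) (h : u.flip {ξ} ≤ v) :
    u.diff v = {ξ} := by
  obtain ⟨h1, h2⟩ := le_iff.1 h
  ext η
  rw [mem_diff, Set.mem_singleton_iff]
  constructor
  · rintro ⟨hu, -, hne⟩
    by_contra hη
    rw [← h2 η hu, app_flip_of_notMem hu (by simpa using hη)] at hne
    exact hne rfl
  · rintro rfl
    refine ⟨hξ, lt_of_lt_of_le hξ h1, ?_⟩
    rw [← h2 η hξ, app_flip_of_mem hξ (Set.mem_singleton _)]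
    exact (one_sub_ne _).symm

theorem le_flip_of_le {s u : Node} (h : s ≤ u) : s ≤ u.flip {s.ht} := by
  obtain ⟨h1, h2⟩ := le_iff.1 h
  refine le_iff.2 ⟨h1, fun ξ hξ => ?_⟩
  rw [app_flip_of_notMem (hξ.trans_le h1) (by simpa using hξ.ne), h2 ξ hξ]

theorem snoc_one_le_flip {s u : Node} (h : s.snoc 0 ≤ u) : s.snoc 1 ≤ u.flip {s.ht} := by
  obtain ⟨h1, h2, h3⟩ := snoc_le_iff.1 h
  refine snoc_le_iff.2 ⟨le_flip_of_le h1, h2, ?_⟩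
  rw [app_flip_of_mem h2 (Set.mem_singleton _), h3]
  rfl

end Node

/-! ### Blocks -/

section Blocks

variable {S : Set Node}

/-- The two halves of a member of a family in `C⁰` with stem `s`. -/
structure IsBlock (s : Node) {n : ℕ} (l r : Fin n → S) : Prop where
  snoc_lt : ∀ k, s.snoc 0 < (l k).1
  strictMono_left : StrictMono l
  strictMono_right : StrictMono r
  flip_lt : ∀ k k', (l k).1.flip {s.ht} < (r k').1

theorem IsBlock.ht_lt {s : Node} {n : ℕ} {l r : Fin n → S} (h : IsBlock s l r) (k k' : Fin n) :
    (l k).1.ht < (r k').1.ht :=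
  Node.ht_strictMono (s := (l k).1.flip {s.ht}) (h.flip_lt k k')

theorem isBlock_singleton {s : Node} {u v : S} (h : s.snoc 0 < u.1) (h' : u.1.flip {s.ht} < v.1) :
    IsBlock s ![u] ![v] where
  snoc_lt k := by rw [Subsingleton.elim k 0]; exact h
  strictMono_left := Subsingleton.strictMono _
  strictMono_right := Subsingleton.strictMono _
  flip_lt k k' := by rw [Subsingleton.elim k 0, Subsingleton.elim k' 0]; exact h'

theorem isBlock_pair {s : Node} {u v p q : S} (h : s.snoc 0 < u.1) (huv : u < v)
    (h' : v.1.flip {s.ht} < p.1) (hpq : p < q) : IsBlock s ![u, v] ![p, q] where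
  snoc_lt k := by
    fin_cases k
    · exact h
    · exact h.trans huv
  strictMono_left := by
    rw [Fin.strictMono_iff_lt_succ]
    intro i
    rw [Subsingleton.elim i 0]
    exact huv
  strictMono_right := by
    rw [Fin.strictMono_iff_lt_succ]
    intro i
    rw [Subsingleton.elim i 0]
    exact hpq
  flip_lt k k' := by
    have h1 : ∀ k, (![u, v] k).1.flip {s.ht} < p.1 := by
      intro k
      fin_cases k
      · exact (Node.flip_lt huv _).trans h'
      · exact h'
    fin_cases k'
    · exact h1 k
    · exact (h1 k).trans hpq

theorem append_ht_bounds {s : Node} {n : ℕ} {l r : Fin n → S} (h : IsBlock s l r)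
    {lo hi : Omega1} (hlo : ∀ k, lo < (l k).1.ht) (hhi : ∀ k, (r k).1.ht ≤ hi) (i : Fin (n + n)) :
    lo < (Fin.append l r i).1.ht ∧ (Fin.append l r i).1.ht ≤ hi := by
  induction i using Fin.addCases with
  | left k =>
    rw [Fin.append_left]
    exact ⟨hlo k, (h.ht_lt k k).le.trans (hhi k)⟩
  | right k =>
    rw [Fin.append_right]
    exact ⟨(hlo k).trans (h.ht_lt k k), hhi k⟩

section

variable {ι : Type*} {s : Node} {n : ℕ} {l r : ι → Fin n → S} {lo hi : ι → Omega1}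

theorem append_ht_lt (hblock : ∀ x, IsBlock s (l x) (r x)) (hlo : ∀ x k, lo x < (l x k).1.ht)
    (hhi : ∀ x k, (r x k).1.ht ≤ hi x) {x y : ι} (h : hi x ≤ lo y) (i j : Fin (n + n)) :
    (Fin.append (l x) (r x) i).1.ht < (Fin.append (l y) (r y) j).1.ht :=
  ((append_ht_bounds (hblock x) (hlo x) (hhi x) i).2.trans h).trans_lt
    (append_ht_bounds (hblock y) (hlo y) (hhi y) j).1

theorem append_injective (hn : 0 < n) (hblock : ∀ x, IsBlock s (l x) (r x))
    (hlo : ∀ x k, lo x < (l x k).1.ht) (hhi : ∀ x k, (r x k).1.ht ≤ hi x)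
    (hsep : ∀ x y, x ≠ y → hi x ≤ lo y ∨ hi y ≤ lo x) :
    Function.Injective fun x => Fin.append (l x) (r x) := by
  intro x y h
  have h : Fin.append (l x) (r x) = Fin.append (l y) (r y) := h
  by_contra hne
  rcases hsep x y hne with h' | h'
  · have := append_ht_lt hblock hlo hhi h' (Fin.castAdd n ⟨0, hn⟩) (Fin.castAdd n ⟨0, hn⟩)
    rw [h] at this
    exact lt_irrefl _ this
  · have := append_ht_lt hblock hlo hhi h' (Fin.castAdd n ⟨0, hn⟩) (Fin.castAdd n ⟨0, hn⟩)
    rw [h] at this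
    exact lt_irrefl _ this

/-- The heights of block `x` lie in the interval `(lo x, hi x]`; disjointness of the intervals gives
both the separation clause and injectivity. -/
theorem isC0_range [Uncountable ι] (hn : 0 < n) (hs : s ∈ S)
    (hblock : ∀ x, IsBlock s (l x) (r x)) (hlo : ∀ x k, lo x < (l x k).1.ht)
    (hhi : ∀ x k, (r x k).1.ht ≤ hi x) (hsep : ∀ x y, x ≠ y → hi x ≤ lo y ∨ hi y ≤ lo x) :
    IsC0 S n (Set.range fun x => Fin.append (l x) (r x)) := by
  have hinj := append_injective hn hblock hlo hhi hsep
  refine ⟨hn, fun hc => ?_, s, hs, ?_, ?_⟩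
  · rw [← Set.image_univ] at hc
    exact Set.not_countable_univ (Set.countable_of_injective_of_countable_image hinj.injOn hc)
  · rintro _ ⟨x, rfl⟩
    have hb := hblock x
    simp only [Fin.append_left, Fin.append_right]
    refine ⟨⟨hb.snoc_lt, fun k k' h => hb.strictMono_left h⟩, ⟨fun k => ?_, fun k k' h =>
      hb.strictMono_right h⟩, hb.ht_lt, fun k k' => ?_⟩
    · exact (Node.snoc_one_le_flip (hb.snoc_lt k).le).trans_lt (hb.flip_lt k k)
    · exact Node.diff_eq_singleton (Node.snoc_le_iff.1 (hb.snoc_lt k).le).2.1 (hb.flip_lt k k').le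
  · rintro _ ⟨x, rfl⟩ _ ⟨y, rfl⟩ hne
    have hxy : x ≠ y := fun h => hne (by rw [h])
    rcases hsep x y hxy with h | h
    · exact Or.inl (append_ht_lt hblock hlo hhi h)
    · exact Or.inr fun i j => append_ht_lt hblock hlo hhi h j i

end

end Blocks

instance : Uncountable Omega1 := by
  rw [← not_countable_iff, ← Set.countable_univ_iff]
  exact Omega1.not_countable_univ

/-! ### Families of pairs of nodes -/

/-- A sequence of pairs of nodes `b α ≤ s α`, of increasing heights. -/
structure PairSeq (S : Set Node) : Type where
  b : Omega1 → S
  s : Omega1 → S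
  le : ∀ α, b α ≤ s α
  ht_lt : ∀ α β, α < β → (s α).1.ht < (b β).1.ht

namespace PairSeq

variable {S : Set Node} (F : PairSeq S)

theorem ht_b_strictMono : StrictMono fun α => (F.b α).1.ht := fun α β h =>
  (Node.ht_mono (F.le α)).trans_lt (F.ht_lt α β h)

theorem le_ht_b (α : Omega1) : α ≤ (F.b α).1.ht := Omega1.le_of_strictMono F.ht_b_strictMono α

theorem le_ht_s (α : Omega1) : α ≤ (F.s α).1.ht := (F.le_ht_b α).trans (Node.ht_mono (F.le α))

theorem s_injective : Function.Injective F.s := by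
  have h : StrictMono fun α => (F.s α).1.ht := fun α β h =>
    (F.ht_lt α β h).trans_le (Node.ht_mono (F.le β))
  exact fun α β e => h.injective (congrArg (fun u : S => u.1.ht) e)

theorem lt_of_ht_lt {α β : Omega1} (h : (F.s α).1.ht < (F.b β).1.ht) : α < β := by
  by_contra hle
  exact ((F.ht_b_strictMono.monotone (not_lt.1 hle)).trans (Node.ht_mono (F.le α))).not_gt h

end PairSeq

/-! ### Homogeneous families contradict `φ₀` -/

section Main

variable {S : Set Node} {c : Sym2 S → Fin 2}

open IsCompleteCoherentSuslin

/-- The choices made at one stage of the construction of a family of blocks of length one. -/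
theorem exists_pair_above (hS : IsCompleteCoherentSuslin S) (F : PairSeq S) {Z : Set Omega1}
    {s : S} (hs : ∀ t, s ≤ t → ¬ {α ∈ Z | t ≤ F.s α}.Countable) (γ : Omega1) :
    ∃ x : Omega1 × Omega1, x.1 ∈ Z ∧ x.2 ∈ Z ∧ γ < (F.b x.1).1.ht ∧
      IsBlock s.1 ![F.b x.1] ![F.b x.2] ∧ (F.s x.1).1.flip {s.1.ht} ≤ (F.s x.2).1 := by
  let s₀ : S := ⟨s.1.snoc 0, hS.snoc_mem s.2 0⟩
  have hs₀ : s ≤ s₀ := (Node.snoc_le_iff.1 (le_refl s₀.1)).1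
  obtain ⟨γ', hγ'⟩ := exists_gt (max γ s₀.1.ht)
  obtain ⟨α, ⟨hα, hsα⟩, hγα⟩ := Omega1.exists_ge_of_not_countable (hs s₀ hs₀) γ'
  have hlt : max γ s₀.1.ht < (F.b α).1.ht := hγ'.trans_le (hγα.trans (F.le_ht_b α))
  -- Taking the second pair above the flip of the first `s`-node makes the halves differ only at the
  -- height of the stem.
  let u : S := ⟨(F.s α).1.flip {s.1.ht}, hS.flip_mem (F.s α).2 (Set.finite_singleton _)⟩
  have hu : s ≤ u := Node.le_flip_of_le (show s.1 ≤ (F.s α).1 from hs₀.trans hsα)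
  obtain ⟨δ, hδ⟩ := exists_gt α
  obtain ⟨α', ⟨hα', huα'⟩, hδα'⟩ := Omega1.exists_ge_of_not_countable (hs u hu) δ
  refine ⟨(α, α'), hα, hα', (le_max_left _ _).trans_lt hlt, isBlock_singleton ?_ ?_, huα'⟩
  · exact lt_of_le_of_le (u := F.s α) hsα (F.le α) ((le_max_right _ _).trans_lt hlt)
  · have h1 : u < F.b α' := lt_of_le_of_le huα' (F.le α') (F.ht_lt α α' (hδ.trans_le hδα'))
    exact lt_of_le_of_lt (Node.flip_mono (F.le α) _) h1

/-- An uncountable homogeneous subfamily contradicts `φ₀(c)`. -/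
theorem not_phi0_of_homogeneous (hS : IsCompleteCoherentSuslin S) (F : PairSeq S) {j : Fin 2}
    {Z : Set Omega1} (hZ : ¬ Z.Countable) (hhom : ∀ α ∈ Z, ∀ β ∈ Z, α < β → F.s α < F.s β →
      c s(F.b α, F.b β) = j) : ¬ Phi0 c := by
  classical
  intro hphi
  obtain ⟨s, hs⟩ := hS.exists_dense F.s_injective hZ
  obtain ⟨f, hf⟩ := Omega1.exists_seq _ (exists_pair_above hS F hs) fun x => (F.s x.2).1.ht
  choose γ hf _ hbd using hf
  have hblock := fun ξ => (hf ξ).2.2.2.1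
  let a : Omega1 → Fin (1 + 1) → S := fun ξ => Fin.append ![F.b (f ξ).1] ![F.b (f ξ).2]
  -- Flipped back, the second `s`-node extends the first one. A relation `σ ξ < σ η` therefore
  -- yields the order of the `s`-nodes in both halves, so that homogeneity applies to both.
  let σ : Omega1 → S := fun ξ =>
    ⟨(F.s (f ξ).2).1.flip {s.1.ht}, hS.flip_mem (F.s _).2 (Set.finite_singleton _)⟩
  have hlo : ∀ ξ (k : Fin 1), γ ξ < (![F.b (f ξ).1] k).1.ht := fun ξ k => by
    rw [Subsingleton.elim k 0]
    exact (hf ξ).2.2.1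
  have hhi : ∀ ξ (k : Fin 1), (![F.b (f ξ).2] k).1.ht ≤ (F.s (f ξ).2).1.ht := fun ξ k => by
    rw [Subsingleton.elim k 0]
    exact Node.ht_mono (F.le _)
  have hsep : ∀ ξ η, ξ ≠ η → (F.s (f ξ).2).1.ht ≤ γ η ∨ (F.s (f η).2).1.ht ≤ γ ξ := by
    intro ξ η hne
    rcases lt_or_gt_of_ne hne with h | h
    · exact Or.inl (hbd η ξ h).le
    · exact Or.inr (hbd ξ η h).le
  have hinj := append_injective one_pos hblock hlo hhi hsep
  have hlt : ∀ ξ η, ξ < η → (F.s (f ξ).2).1.ht < (F.b (f η).1).1.ht := fun ξ η h =>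
    (hbd η ξ h).trans (hf η).2.2.1
  have hb12 : ∀ ξ, (F.b (f ξ).1).1.ht < (F.b (f ξ).2).1.ht := fun ξ => (hblock ξ).ht_lt 0 0
  have hσ : Function.Injective σ := by
    have hmono : StrictMono fun ξ => (σ ξ).1.ht := fun ξ η h =>
      ((hlt ξ η h).trans (hb12 η)).trans_le (show (F.b (f η).2).1.ht ≤ (F.s (f η).2).1.ht from
        Node.ht_mono (F.le _))
    exact fun ξ η e => hmono.injective (congrArg (fun u : S => u.1.ht) e)
  obtain ⟨ξ, η, hξη, hσξη, hgood⟩ := hphi 1 (fun _ => 1) (fun _ => Set.range a) one_pos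
    (fun _ => isC0_range one_pos s.2 hblock hlo hhi hsep) σ (fun _ ξ => {a ξ}) hσ
    (fun _ ξ => by simp) (fun _ ξ η hne => by
      simpa using fun h => hne (hinj h))
  obtain ⟨i, hi⟩ := hgood 0 (a ξ) (by simp) (a η) (by simp)
  obtain ⟨h1, h2⟩ := hi 0 0
  simp only [a, Fin.append_left, Fin.append_right, Matrix.cons_val_zero] at h1 h2
  have hs2 : F.s (f ξ).2 < F.s (f η).2 := by
    have h := Node.flip_lt (show (σ ξ).1 < (σ η).1 from hσξη) {s.1.ht}
    simp only [σ, Node.flip_flip] at h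
    exact h
  have hle : ∀ ξ, F.s (f ξ).1 ≤ σ ξ := fun ξ => by
    have h := Node.flip_mono (hf ξ).2.2.2.2 {s.1.ht}
    rwa [Node.flip_flip] at h
  have hht : (F.s (f ξ).1).1.ht < (F.b (f η).1).1.ht :=
    (F.ht_lt _ _ (F.ht_b_strictMono.lt_iff_lt.1 (hb12 ξ))).trans
      ((Node.ht_mono (F.le _)).trans_lt (hlt ξ η hξη))
  have hs1 : F.s (f ξ).1 < F.s (f η).1 := lt_of_le_of_le ((hle ξ).trans hσξη.le) (hle η)
    (hht.trans_le (Node.ht_mono (F.le _)))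
  rw [hhom _ (hf ξ).1 _ (hf η).1 (F.lt_of_ht_lt hht) hs1] at h1
  rw [hhom _ (hf ξ).2.1 _ (hf η).2.1
    (F.lt_of_ht_lt ((hlt ξ η hξη).trans (hb12 η))) hs2, ← h1] at h2
  exact Node.one_sub_ne _ h2.symm

end Main

end SuslinPFA
end

noncomputable section

namespace SuslinPFA

open IsCompleteCoherentSuslin

/-! ### Blocked refinements from small names -/

namespace PairSeq

variable {S : Set Node}

/-- Each node `t` is above only those `s α` whose `b α` has, with some member of a finite set
given by `t`, a colour other than `j`. -/
def Blocked (c : Sym2 S → Fin 2) (F : PairSeq S) (j : Fin 2) : Prop :=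
  ∀ t : S, ∃ B : Finset S, ∀ α, F.s α < t → ∃ v ∈ B, F.b α < v ∧ c s(F.b α, v) ≠ j

variable {c : Sym2 S → Fin 2}

/-- Extending the `s`-nodes only weakens what has to be blocked, so a colour once blocked stays
blocked under later refinements. -/
theorem Blocked.of_refines {F F' : PairSeq S} {j : Fin 2} (h : F.Blocked c j)
    {f : Omega1 → Omega1} (hb : ∀ α, F'.b α = F.b (f α)) (hs : ∀ α, F.s (f α) ≤ F'.s α) :
    F'.Blocked c j := by
  intro t
  obtain ⟨B, hB⟩ := h t
  exact ⟨B, fun α hα => by rw [hb]; exact hB _ ((hs α).trans_lt hα)⟩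

/-- If below each node the differences of `t α` and `s α`, for the `t α` below that node, are all
included in one finite set, then one difference occurs uncountably often. -/
theorem exists_diff_eq (hS : IsCompleteCoherentSuslin S) {K : Set Omega1} (hK : ¬ K.Countable)
    {s t : Omega1 → S} (ht : ∀ α, α ≤ (t α).1.ht)
    (hfin : ∀ w : S, ∃ X : Set Omega1, X.Finite ∧
      ∀ α ∈ K, t α < w → (t α).1.diff (s α).1 ⊆ X) :
    ∃ D : Set Omega1, ¬ {α ∈ K | (t α).1.diff (s α).1 = D}.Countable := by
  by_contra! h
  set φ : Omega1 → Set Omega1 := fun α => (t α).1.diff (s α).1 with hφ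
  have hφK : ¬ (φ '' K).Countable := fun hc =>
    hK (Set.Countable.mono (fun α hα => by
      simp only [Set.mem_iUnion]
      exact ⟨φ α, Set.mem_image_of_mem φ hα, hα, rfl⟩) (hc.biUnion fun D _ => h D))
  -- On a transversal `K'` the differences are pairwise distinct. Some `w` lies above infinitely
  -- many `t α` with `α ∈ K'`, whose differences would all be subsets of one finite set.
  obtain ⟨K', hK'K, hbij⟩ := Set.exists_subset_bijOn K φ
  have hK' : ¬ K'.Countable := fun hc => hφK (hbij.image_eq ▸ hc.image φ)
  have hW : ¬ (t '' K').Countable := fun hc => by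
    obtain ⟨γ, hγ⟩ := Omega1.exists_gt_of_countable (hc.image fun u => u.1.ht)
    obtain ⟨α, hα, hγα⟩ := Omega1.exists_ge_of_not_countable hK' γ
    exact (hγα.trans (ht α)).not_gt (hγ _ ⟨_, ⟨α, hα, rfl⟩, rfl⟩)
  obtain ⟨w, -, hinf⟩ := hS.exists_infinite_below hW
  obtain ⟨X, hX, hsub⟩ := hfin w
  have hfin' : {α ∈ K' | t α < w}.Finite :=
    Set.Finite.of_finite_image (f := φ)
      (hX.finite_subsets.subset (by
        rintro _ ⟨α, hα, rfl⟩
        exact hsub α (hK'K hα.1) hα.2))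
      (hbij.injOn.mono fun α hα => hα.1)
  refine hinf ((hfin'.image t).subset ?_)
  rintro _ ⟨⟨α, hα, rfl⟩, hlt⟩
  exact ⟨α, ⟨hα, hlt⟩, rfl⟩

/-- Under `PFA(S)` and `φ₀(c)`, any sequence of pairs has a refinement that is blocked for a
given colour. -/
theorem exists_blocked (hS : IsCompleteCoherentSuslin S) (hPFA : PFA S) (hφ : Phi0 c)
    (F : PairSeq S) (j : Fin 2) : ∃ F' : PairSeq S, F'.Blocked c j ∧
      ∃ f : Omega1 → Omega1, ∀ α, F'.b α = F.b (f α) ∧ F.s (f α) ≤ F'.s α := by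
  classical
  -- Since the relation is an implication, its failure provides both `F.s α < F.s β` and a colour
  -- other than `j`.
  have hsm : HasSmallName S fun α β => F.s α < F.s β → c s(F.b α, F.b β) = j := by
    by_contra h
    obtain ⟨Z, hZ, hhom⟩ := exists_homogeneous hS hPFA h
    exact not_phi0_of_homogeneous hS F hZ hhom hφ
  obtain ⟨K, hK, t, hsm⟩ := hsm
  choose t' htt' hht using fun α => hS.exists_ge_ht_ge (t α) (F.s α).1.ht
  have hsm' : ∀ w : S, ∃ B : Finset Omega1, ∀ α ∈ K, t' α < w →
      ∃ β ∈ B, α < β ∧ F.s α < F.s β ∧ c s(F.b α, F.b β) ≠ j := by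
    intro w
    obtain ⟨B, hB⟩ := hsm w
    refine ⟨B, fun α hα hlt => ?_⟩
    obtain ⟨β, hβ, hαβ, hne⟩ := hB α hα
      (((F.le_ht_s α).trans (hht α)).trans_lt (ht_strictMono hlt)) ((htt' α).trans_lt hlt)
    push Not at hne
    exact ⟨β, hβ, hαβ, hne⟩
  -- Whenever `t' α < w`, some `β ∈ B` has `F.s α < F.s β`, so the difference of `t' α` and `F.s α`
  -- is included in that of `w` and `F.s β`, which is finite by coherence.
  obtain ⟨D, hD⟩ := exists_diff_eq hS hK (s := F.s) (t := t')
    (fun α => (F.le_ht_s α).trans (hht α)) fun w => by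
      obtain ⟨B, hB⟩ := hsm' w
      refine ⟨⋃ β ∈ B, w.1.diff (F.s β).1,
        B.finite_toSet.biUnion fun β _ => hS.coherent _ w.2 _ (F.s β).2, fun α hα hlt => ?_⟩
      obtain ⟨β, hβ, -, hs, -⟩ := hB α hα hlt
      exact (Node.diff_mono hlt.le hs.le).trans
        (Set.subset_biUnion_of_mem (u := fun β => w.1.diff (F.s β).1) hβ)
  have hDfin : D.Finite := by
    obtain ⟨α, ⟨-, hα⟩, -⟩ := Omega1.exists_ge_of_not_countable hD (Classical.arbitrary _)
    exact hα ▸ hS.coherent _ (t' α).2 _ (F.s α).2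
  let s' : Omega1 → S := fun α => ⟨(t' α).1.flip D, hS.flip_mem (t' α).2 hDfin⟩
  have hs' : ∀ α, (t' α).1.diff (F.s α).1 = D → F.s α ≤ s' α := fun α hα => by
    have h := Node.le_flip_diff (hht α)
    rw [hα] at h
    exact h
  obtain ⟨f, hf⟩ := Omega1.exists_seq
    (fun γ α => (α ∈ K ∧ (t' α).1.diff (F.s α).1 = D) ∧ γ ≤ α)
    (fun γ => Omega1.exists_ge_of_not_countable hD γ) fun α => (s' α).1.ht
  choose γ hf _ hbd using hf
  refine ⟨⟨fun ξ => F.b (f ξ), fun ξ => s' (f ξ),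
    fun ξ => (F.le _).trans (hs' _ (hf ξ).1.2), fun ξ η h => ?_⟩, fun w => ?_, f, fun ξ =>
    ⟨rfl, hs' _ (hf ξ).1.2⟩⟩
  · exact ((hbd η ξ h).trans_le (hf η).2).trans_le (F.le_ht_b _)
  -- Flipping at `D` is an involution preserving the order, so `s' α < w` turns into `t' α <
  -- w.1.flip D`.
  · obtain ⟨B, hB⟩ := hsm' ⟨w.1.flip D, hS.flip_mem w.2 hDfin⟩
    refine ⟨B.image F.b, fun ξ hξ => ?_⟩
    have hlt : (s' (f ξ)).1.flip D < w.1.flip D := Node.flip_lt hξ D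
    simp only [s', Node.flip_flip] at hlt
    obtain ⟨β, hβ, hαβ, hs, hne⟩ := hB (f ξ) (hf ξ).1.1 hlt
    exact ⟨F.b β, Finset.mem_image_of_mem _ hβ, lt_of_le_of_le ((F.le _).trans hs.le) (F.le β)
      (F.ht_b_strictMono hαβ), hne⟩

end PairSeq

/-! ### Sequences blocked for both colours contradict `φ₀` -/

section Final

variable {S : Set Node} {c : Sym2 S → Fin 2}

theorem exists_isBlock (hS : IsCompleteCoherentSuslin S) (s : Node) {u v : S}
    (h : s.snoc 0 < u.1) (huv : u < v) : ∃ r : Fin 2 → S, IsBlock s ![u, v] r := by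
  obtain ⟨p, hp, -⟩ := hS.exists_gt ⟨v.1.flip {s.ht}, hS.flip_mem v.2 (Set.finite_singleton _)⟩
    v.1.ht
  obtain ⟨q, hq, -⟩ := hS.exists_gt p p.1.ht
  exact ⟨_, isBlock_pair h huv hp hq⟩

theorem Omega1.IsLim.exists_bound {l : Omega1} (hl : Omega1.IsLim l) {X : Set Omega1}
    (hX : X.Finite) (h : ∀ x ∈ X, x < l) : ∃ z < l, ∀ x ∈ X, x ≤ z := by
  obtain ⟨a, ha⟩ := hl.1
  obtain ⟨z, hz, hmax⟩ := Set.exists_max_image (insert a X) id (hX.insert a) ⟨a, Set.mem_insert _ _⟩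
  refine ⟨z, ?_, fun x hx => hmax x (Set.mem_insert_of_mem _ hx)⟩
  rcases hz with rfl | hz
  exacts [ha, h z hz]

/-- The data chosen at one stage of the construction of a finite set of families of blocks of
length two. -/
structure Stage (S : Set Node) (n : ℕ) : Type where
  node : S
  index : Omega1
  low : S
  up : Fin n → S
  right : Fin n → Fin 2 → S
  top : S
  right' : Fin 2 → S
  mid : Omega1
  bound : Omega1

/-- The stage `x` lies above `γ`, has the stem `s`, and its nodes `up` exhaust the members of
`B (node x)` above `node x`. -/
structure Stage.IsGood (F : PairSeq S) (s : Node) (B : S → Finset S) (Λ : Set S) {n : ℕ}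
    (γ : Omega1) (x : Stage S n) : Prop where
  mem : x.node ∈ Λ
  lt_low : γ < x.low.1.ht
  low_lt : x.low < x.node
  exists_up : ∀ u ∈ B x.node, x.node ≤ u → ∃ i, x.up i = u
  isBlock : ∀ i, IsBlock s ![x.low, x.up i] (x.right i)
  right_le : ∀ i k, (x.right i k).1.ht ≤ x.mid
  node_le : x.node ≤ F.s x.index
  mid_lt : x.mid < (F.b x.index).1.ht
  lt_top : F.b x.index < x.top
  isBlock' : IsBlock s ![F.b x.index, x.top] x.right'
  right_le' : ∀ k, (x.right' k).1.ht ≤ x.bound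
  s_lt : (F.s x.index).1.ht < x.bound

/-- Since `node` has limit height, `low` fits between `γ` and `node`. The pair with index `index` is
chosen after `mid` bounds the first blocks, so that its own block lies above them. -/
theorem exists_isGood (hS : IsCompleteCoherentSuslin S) (F : PairSeq S) {s : S}
    (hs : ∀ t, s ≤ t → ¬ {α ∈ Set.univ | t ≤ F.s α}.Countable) {B : S → Finset S} {Λ : Set S}
    {n : ℕ} (hΛ : ∀ γ, ∃ t ∈ Λ, γ < t.1.ht)
    (h : ∀ t ∈ Λ, s.1.snoc 0 ≤ t.1 ∧ Omega1.IsLim t.1.ht ∧ ∃ up : Fin n → S,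
      (∀ i, t ≤ up i) ∧ ∀ u ∈ B t, t ≤ u → ∃ i, up i = u) (γ : Omega1) :
    ∃ x : Stage S n, x.IsGood F s.1 B Λ γ := by
  let s₀ : S := ⟨s.1.snoc 0, hS.snoc_mem s.2 0⟩
  obtain ⟨t, ht, hγt⟩ := hΛ (max γ s₀.1.ht)
  obtain ⟨hst, hlim, up, hup, hup'⟩ := h t ht
  obtain ⟨κ, hκ, hγκ⟩ := hlim.2 _ hγt
  obtain ⟨w, hw, rfl⟩ := hS.exists_restr t hκ.le
  have hwt : w < t := lt_of_le hw hκ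
  have hsw : s₀ < w := lt_of_le_of_le hst hw ((le_max_right _ _).trans_lt hγκ)
  choose r hr using fun i => exists_isBlock hS s.1 hsw (hwt.trans_le (hup i))
  obtain ⟨mid, hmid⟩ := Omega1.exists_gt_of_countable
    (Set.countable_range fun p : Fin n × Fin 2 => (r p.1 p.2).1.ht)
  obtain ⟨δ, hδ⟩ := NoMaxOrder.exists_gt (max mid s₀.1.ht)
  obtain ⟨α, ⟨-, hα⟩, hδα⟩ := Omega1.exists_ge_of_not_countable
    (hs t ((Node.snoc_le_iff.1 (le_refl s₀.1)).1.trans hst)) δ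
  have hlt : max mid s₀.1.ht < (F.b α).1.ht := hδ.trans_le (hδα.trans (F.le_ht_b α))
  obtain ⟨v, hv, -⟩ := hS.exists_gt (F.b α) γ
  obtain ⟨r', hr'⟩ := exists_isBlock hS s.1 (u := F.b α)
    (show s₀ < F.b α from lt_of_le_of_le (hst.trans hα : s₀ ≤ F.s α) (F.le α)
      ((le_max_right _ _).trans_lt hlt)) hv
  obtain ⟨top, htop⟩ := Omega1.exists_gt_of_countable
    ((Set.countable_range fun k => (r' k).1.ht).insert (F.s α).1.ht)
  exact ⟨⟨t, α, w, up, r, v, r', mid, top⟩,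
    { mem := ht
      lt_low := (le_max_left _ _).trans_lt hγκ
      low_lt := hwt
      exists_up := hup'
      isBlock := hr
      right_le := fun i k => (hmid _ ⟨(i, k), rfl⟩).le
      node_le := hα
      mid_lt := (le_max_left _ _).trans_lt hlt
      lt_top := hv
      isBlock' := hr'
      right_le' := fun k => (htop _ (Set.mem_insert_of_mem _ ⟨k, rfl⟩)).le
      s_lt := htop _ (Set.mem_insert _ _) }⟩

/-- Given a finite set for each node `t`, there are cofinally many nodes of limit height for
which the members of that set that are not above `t` branch off below a fixed height. -/
theorem exists_uniform (hS : IsCompleteCoherentSuslin S) (s₀ : S) (B : S → Finset S) :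
    ∃ (θ : Omega1) (n : ℕ) (Λ : Set S), 0 < n ∧ (∀ γ, ∃ t ∈ Λ, γ < t.1.ht) ∧
      ∀ t ∈ Λ, (∀ u ∈ B t, ∀ b, b < u → b < t → θ < b.1.ht → t ≤ u) ∧
        s₀ ≤ t ∧ Omega1.IsLim t.1.ht ∧ ∃ up : Fin n → S,
      (∀ i, t ≤ up i) ∧ ∀ u ∈ B t, t ≤ u → ∃ i, up i = u := by
  classical
  have hT : ∀ l, ∃ t : S, s₀.1.ht ≤ l → s₀ ≤ t ∧ t.1.ht = l := fun l => by
    by_cases h : s₀.1.ht ≤ l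
    · obtain ⟨t, ht⟩ := hS.exists_ge_ht_eq s₀ h
      exact ⟨t, fun _ => ht⟩
    · exact ⟨s₀, fun h' => absurd h' h⟩
  choose T hT using hT
  -- By coherence only finitely many places below `l` matter: the differences of `T l` from the
  -- members of `B (T l)`, and the heights of these below `l`. Their bound is a regressive function
  -- of `l`.
  have hζ : ∀ l, ∃ z, Omega1.IsLim l → z < l ∧ ∀ v ∈ B (T l),
      (∀ ξ < l, ξ ∈ (T l).1.diff v.1 → ξ ≤ z) ∧ (v.1.ht < l → v.1.ht ≤ z) := by
    intro l
    by_cases hl : Omega1.IsLim l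
    · obtain ⟨z, hz, hle⟩ := hl.exists_bound (X := {ξ | ξ < l ∧ ξ ∈
          (⋃ v ∈ B (T l), (T l).1.diff v.1) ∪ (fun v : S => v.1.ht) '' (B (T l) : Set S)})
        ((((B (T l)).finite_toSet.biUnion fun v _ => hS.coherent _ (T l).2 _ v.2).union
          ((B (T l)).finite_toSet.image _)).subset fun ξ h => h.2) fun ξ h => h.1
      exact ⟨z, fun _ => ⟨hz, fun v hv => ⟨fun ξ hξ h => hle ξ ⟨hξ, Or.inl
        (Set.mem_biUnion (t := fun v : S => (T l).1.diff v.1) (Finset.mem_coe.2 hv) h)⟩,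
        fun h => hle _ ⟨h, Or.inr ⟨v, hv, rfl⟩⟩⟩⟩⟩
    · exact ⟨l, fun h => absurd h hl⟩
  choose ζ hζ using hζ
  obtain ⟨θ, hθ⟩ := Omega1.pressing_down ζ fun l hl => (hζ l hl).1
  -- Inserting `T l` ensures `0 < n`; fixing the cardinality lets the nodes above `t` be indexed by
  -- the same `Fin n` for all `t`.
  let V : Omega1 → Finset S := fun l => insert (T l) ((B (T l)).filter (T l ≤ ·))
  obtain ⟨n, hn⟩ : ∃ n, ¬ {l | (Omega1.IsLim l ∧ ζ l ≤ θ) ∧ (V l).card = n}.Countable := by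
    by_contra! h
    refine hθ ((Set.countable_iUnion h).mono fun l hl => ?_)
    exact Set.mem_iUnion.2 ⟨(V l).card, hl, rfl⟩
  refine ⟨θ, n, T '' {l | ((Omega1.IsLim l ∧ ζ l ≤ θ) ∧ (V l).card = n) ∧ s₀.1.ht ≤ l},
    ?_, fun γ => ?_, ?_⟩
  · obtain ⟨l, ⟨-, hl⟩, -⟩ := Omega1.exists_ge_of_not_countable hn θ
    exact hl ▸ Finset.card_pos.2 ⟨_, Finset.mem_insert_self _ _⟩
  · obtain ⟨δ, hδ⟩ := NoMaxOrder.exists_gt (max γ s₀.1.ht)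
    obtain ⟨l, hl, hδl⟩ := Omega1.exists_ge_of_not_countable hn δ
    have hsl := ((le_max_right _ _).trans_lt (hδ.trans_le hδl)).le
    exact ⟨T l, ⟨l, ⟨hl, hsl⟩, rfl⟩,
      ((le_max_left _ _).trans_lt (hδ.trans_le hδl)).trans_eq (hT l hsl).2.symm⟩
  · rintro _ ⟨l, ⟨⟨⟨hl, hζθ⟩, hcard⟩, hsl⟩, rfl⟩
    obtain ⟨hst, hht⟩ := hT l hsl
    obtain ⟨-, hζ⟩ := hζ l hl
    refine ⟨fun u hu b hbu hbt hθb => ?_, hst, hht.symm ▸ hl, ?_⟩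
    · obtain ⟨h1, h2⟩ := hζ u hu
      have hle : (T l).1.ht ≤ u.1.ht := by
        rw [hht]
        by_contra hlt
        exact ((h2 (not_le.1 hlt)).trans hζθ).not_gt (hθb.trans (ht_strictMono hbu))
      refine Node.le_of_diff_empty hle fun ξ hξ hd => ?_
      -- Any difference would be at most `θ`, hence below the height of `b`, where `t` and `u`
      -- agree.
      have hξb : ξ < b.1.ht := ((h1 ξ (hξ.trans_eq hht) hd).trans hζθ).trans_lt hθb
      refine (Node.mem_diff.1 hd).2.2 ?_
      rw [← (Node.le_iff.1 hbt.le).2 ξ hξb, ← (Node.le_iff.1 hbu.le).2 ξ hξb]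
    · let e := (Finset.equivFinOfCardEq hcard).symm
      refine ⟨fun i => (e i).1, fun i => ?_, fun u hu htu => ?_⟩
      · rcases Finset.mem_insert.1 (e i).2 with h | h
        · exact h.ge
        · exact (Finset.mem_filter.1 h).2
      · exact ⟨e.symm ⟨u, Finset.mem_insert_of_mem (Finset.mem_filter.2 ⟨hu, htu⟩)⟩, by simp⟩

/-- A sequence of pairs that is blocked for both colours contradicts `φ₀(c)`. -/
theorem not_phi0_of_blocked (hS : IsCompleteCoherentSuslin S) (F : PairSeq S)
    (hF : ∀ j, F.Blocked c j) : ¬ Phi0 c := by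
  classical
  intro hphi
  choose B hB using hF
  obtain ⟨s, hs⟩ := hS.exists_dense F.s_injective Omega1.not_countable_univ
  obtain ⟨θ, n, Λ, hn, hΛ, h⟩ := exists_uniform hS ⟨s.1.snoc 0, hS.snoc_mem s.2 0⟩
    fun t => B 0 t ∪ B 1 t
  -- The maximum with `θ` puts every `F.b (f ξ).index` above `θ`, so that the uniform bound on
  -- branching applies to it.
  obtain ⟨f, hf⟩ := Omega1.exists_seq _ (fun γ =>
    exists_isGood hS F hs (n := n) hΛ (fun t ht => (h t ht).2) (max γ θ)) Stage.bound
  choose γ hf _ hbd using hf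
  -- Each stage gives two blocks to the `i`-th family: `true` marks the one starting with `F.b`,
  -- used as the earlier block, and `false` marks `low` with the `i`-th blocking node. The node
  -- `top` only pads the former to length two.
  let l : Fin n → Omega1 × Bool → Fin 2 → S := fun i x =>
    bif x.2 then ![F.b (f x.1).index, (f x.1).top] else ![(f x.1).low, (f x.1).up i]
  let r : Fin n → Omega1 × Bool → Fin 2 → S := fun i x =>
    bif x.2 then (f x.1).right' else (f x.1).right i
  let lo : Omega1 × Bool → Omega1 := fun x => bif x.2 then (f x.1).mid else γ x.1
  let hi : Omega1 × Bool → Omega1 := fun x => bif x.2 then (f x.1).bound else (f x.1).mid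
  have hlow : ∀ ξ, γ ξ < (f ξ).low.1.ht := fun ξ => (le_max_left _ _).trans_lt (hf ξ).lt_low
  have hmid : ∀ ξ, max (γ ξ) θ < (f ξ).mid := fun ξ =>
    ((hf ξ).lt_low.trans (((hf ξ).isBlock ⟨0, hn⟩).ht_lt 0 0)).trans_le ((hf ξ).right_le _ 0)
  have hmb : ∀ ξ, (f ξ).mid < (f ξ).bound := fun ξ =>
    ((hf ξ).mid_lt.trans ((hf ξ).isBlock'.ht_lt 0 0)).trans_le ((hf ξ).right_le' 0)
  have hblock : ∀ i x, IsBlock s.1 (l i x) (r i x) := by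
    rintro i ⟨ξ, _ | _⟩
    exacts [(hf ξ).isBlock i, (hf ξ).isBlock']
  have hlo : ∀ i x k, lo x < (l i x k).1.ht := by
    rintro i ⟨ξ, _ | _⟩ k <;> fin_cases k
    · exact hlow ξ
    · exact (hlow ξ).trans (ht_strictMono (((hf ξ).isBlock i).strictMono_left Fin.zero_lt_one))
    · exact (hf ξ).mid_lt
    · exact (hf ξ).mid_lt.trans (ht_strictMono (hf ξ).lt_top)
  have hhi : ∀ i x k, (r i x k).1.ht ≤ hi x := by
    rintro i ⟨ξ, _ | _⟩ k
    exacts [(hf ξ).right_le i k, (hf ξ).right_le' k]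
  have hhib : ∀ x, hi x ≤ (f x.1).bound := by
    rintro ⟨ξ, _ | _⟩
    exacts [(hmb ξ).le, le_rfl]
  have hlog : ∀ x, γ x.1 ≤ lo x := by
    rintro ⟨ξ, _ | _⟩
    exacts [le_rfl, ((le_max_left _ _).trans_lt (hmid ξ)).le]
  have hsep' : ∀ x y : Omega1 × Bool, x.1 < y.1 → hi x ≤ lo y := fun x y hxy =>
    ((hhib x).trans (hbd y.1 x.1 hxy).le).trans (hlog y)
  have hsep : ∀ x y, x ≠ y → hi x ≤ lo y ∨ hi y ≤ lo x := by
    rintro ⟨ξ, a⟩ ⟨η, b⟩ hne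
    rcases lt_trichotomy ξ η with hlt | rfl | hlt
    · exact Or.inl (hsep' _ _ hlt)
    · cases a <;> cases b
      exacts [absurd rfl hne, Or.inl le_rfl, Or.inr le_rfl, absurd rfl hne]
    · exact Or.inr (hsep' _ _ hlt)
  have hinj := fun i => append_injective two_pos (hblock i) (hlo i) (hhi i) hsep
  have hsb : ∀ ξ η, ξ < η → (F.s (f ξ).index).1.ht < (f η).low.1.ht := fun ξ η hlt =>
    ((hf ξ).s_lt.trans (hbd η ξ hlt)).trans (hlow η)
  have hσ : Function.Injective fun ξ => F.s (f ξ).index := by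
    have hmono : StrictMono fun ξ => (F.s (f ξ).index).1.ht := fun ξ η hlt =>
      ((hsb ξ η hlt).trans (ht_strictMono (hf η).low_lt)).trans_le (ht_mono (hf η).node_le)
    exact fun ξ η e => hmono.injective (congrArg (fun u : S => u.1.ht) e)
  let a : Fin n → Omega1 × Bool → Fin (2 + 2) → S := fun i x => Fin.append (l i x) (r i x)
  obtain ⟨ξ, η, hξη, hlt, hgood⟩ := hphi n (fun _ => 2) (fun i => Set.range (a i)) hn
    (fun i => isC0_range two_pos s.2 (hblock i) (hlo i) (hhi i) hsep) (fun ξ => F.s (f ξ).index)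
    (fun i ξ => {a i (ξ, false), a i (ξ, true)}) hσ
    (fun i ξ => by
      intro y hy
      simp only [Finset.coe_insert, Finset.coe_singleton, Set.mem_insert_iff,
        Set.mem_singleton_iff] at hy
      rcases hy with rfl | rfl <;> exact ⟨_, rfl⟩)
    (fun i ξ η hne => by
      rw [Finset.disjoint_left]
      intro y hy hy'
      simp only [Finset.mem_insert, Finset.mem_singleton] at hy hy'
      rcases hy with rfl | rfl <;> rcases hy' with h | h <;>
        exact hne (congrArg Prod.fst (hinj i h)))
  have hcol : ∀ i, c s(F.b (f ξ).index, (f η).low) = c s(F.b (f ξ).index, (f η).up i) := by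
    intro i
    obtain ⟨j, hj⟩ := hgood i (a i (ξ, true)) (by simp) (a i (η, false)) (by simp)
    have h0 := (hj 0 0).1
    have h1 := (hj 0 1).1
    simp only [a, Fin.append_left] at h0 h1
    exact h0.trans h1.symm
  obtain ⟨hup, -⟩ := h _ (hf η).mem
  have hslt : F.s (f ξ).index < (f η).node := lt_of_le_of_le hlt.le (hf η).node_le
    ((hsb ξ η hξη).trans (ht_strictMono (hf η).low_lt))
  -- Blocking for the very colour taken at `low` gives a node `v` of another colour. It must be
  -- above `node`, since `b` is above `θ` and below both, so it is one of the `up i`, contrary to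
  -- `hcol`.
  obtain ⟨v, hv, hbv, hne⟩ := hB (c s(F.b (f ξ).index, (f η).low)) _ _ hslt
  have hv' : v ∈ B 0 (f η).node ∪ B 1 (f η).node := by
    rw [Finset.mem_union]
    generalize c s(F.b (f ξ).index, (f η).low) = j at hv
    fin_cases j
    exacts [Or.inl hv, Or.inr hv]
  obtain ⟨i, rfl⟩ := (hf η).exists_up v hv' (hup v hv' _ hbv ((F.le _).trans_lt hslt)
    (((le_max_right _ _).trans_lt (hmid ξ)).trans (hf ξ).mid_lt))
  exact hne (hcol i).symm

end Final

end SuslinPFA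

theorem mainTheorem4 (S : Set SuslinPFA.Node) (hS : SuslinPFA.IsSuslinTree S)
    (hcoherent : SuslinPFA.IsCoherent S) (hcomplete : SuslinPFA.IsComplete S)
    (c : Sym2 S → Fin 2) (hPFA : SuslinPFA.PFA S) : ¬ SuslinPFA.Phi0 c := by
  intro hphi
  have hS : SuslinPFA.IsCompleteCoherentSuslin S := ⟨hS, hcoherent, hcomplete⟩
  choose e he using fun α => (hS.exists_ht_ge α).imp fun t ht => ht
  choose e' _ he' using fun α => hS.exists_restr (e α) (he α)
  -- The starting sequence has one node at each height, with `b` and `s` equal.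
  let F : SuslinPFA.PairSeq S := ⟨e', e', fun _ => le_rfl, fun α β h => by rwa [he', he']⟩
  obtain ⟨F₀, h₀, -⟩ := F.exists_blocked hS hPFA hphi 0
  obtain ⟨F₁, h₁, f, hf⟩ := F₀.exists_blocked hS hPFA hphi 1
  refine SuslinPFA.not_phi0_of_blocked hS F₁ (fun j => ?_) hphi
  fin_cases j
  · exact h₀.of_refines (fun α => (hf α).1) fun α => (hf α).2
  · exact h₁
end
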